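/- Let $\ell\in\mathbb Z_{\ge 0}$, let $\Pi=\{z\in\mathbb C:\operatorname{Re}z>0\}$, and let $A$ be the weighted Bergman space of analytic functions $h:\Pi\to\mathbb C$ with $$\|h\|^2=\frac1\pi\int_{-\infty}^{\infty}\int_0^\infty x^\ell|h(x+iy)|^2\,dx\,dy<\infty .$$ For analytic $f:\Pi\to\mathbb C$ and $g:\Pi\to\Pi$, the maximal weighted composition operator $W_{f,g,\max}$ has domain $\{h\in A: f\cdot(h\circ g)\in A\}$ and acts by $W_{f,g,\max}h=f\cdot(h\circ g)$. It is called bounded if its domain is $A$ and $\|W_{f,g,\max}h\|\le L\|h\|$ for some constant $L>0$ and all $h\in A$. For a conjugation (antilinear isometric involution) $J$ on $A$, an operator $T$ in $A$ is called $J$-selfadjoint if it is densely defined and $T=JT^*J$, with equality of domains. Let $\mathcal C_\star$ be the conjugation $$\mathcal C_\star h(z)=\frac{1}{z^{\ell+2}}\,\overline{h(1/\overline z)} .$$ For $b\in\mathbb C\setminus\{0\}$ and $c\in\mathbb R$ put $s=|b|^{2/(\ell+2)}$, and let $U_{b,c}$ be the unitary operator $U_{b,c}h(z)=b\,h(sz+ic)$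 on $A$. Theorem. Let $\ell\in\mathbb Z_{\ge0}$, $b\in\mathbb C\setminus\{0\}$, $c\in\mathbb R$, and let $f:\Pi\to\mathbb C$ and $g:\Pi\to\Pi$ be analytic. Put $\widehat f(z)=f(s^{-1}(z-ic))$ and $\widehat g(z)=s\,g(s^{-1}(z-ic))+ic$. Then $W_{\widehat f,\widehat g,\max}=U_{b,c}^*W_{f,g,\max}U_{b,c}$, with equality of domains, and the following assertions are equivalent. 1. $W_{f,g,\max}$ is $U_{b,c}\,\mathcal C_\star U_{b,c}^*$-selfadjoint. 2. $U_{b,c}^*W_{f,g,\max}U_{b,c}$ is $\mathcal C_\star$-selfadjoint. 3. Either $f\equiv0$ on $\Pi$, or one of the following three cases holds for all $w\in\Pi$. - (a) $g(w)=s^{-1}(\alpha-ic)$ and $f(w)=\dfrac{\beta}{(1+\alpha(sw+ic))^{\ell+2}}$, for some $\alpha\in\Pi$ and $\beta\in\mathbb C$. - (b) $g(w)=\lambda(w+ics^{-1})-ics^{-1}$ and $f(w)=\theta$, for some real $\lambda>0$ and some $\theta\in\mathbb C$. - (c) $g(w)=s^{-1}\left(\dfrac{1-\delta\kappa}{sw+ic+\kappa}+\delta-ic\right)$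 and $f(w)=\dfrac{r}{(sw+ic+\kappa)^{\ell+2}}$, for some $\delta,\kappa,r\in\mathbb C$ such that either $\operatorname{Re}\delta=0$, $\delta\kappa\in\mathbb R$, $\delta\kappa<1$ and $\operatorname{Re}\kappa\ge0$, or $$\operatorname{Re}\delta>0\quad\text{and}\quad 0\le\operatorname{Re}\kappa-\frac{\operatorname{Re}(\delta\kappa-1)+|\delta\kappa-1|}{2\operatorname{Re}\delta}.$$ If these assertions hold, then $W_{f,g,\max}$ is bounded. -/

import Mathlib

open MeasureTheory Set ComplexConjugate

noncomputable section

/-- The open right half-plane. -/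
def rightHalfPlane : Set ℂ := {z | 0 < z.re}

theorem isOpen_rightHalfPlane : IsOpen rightHalfPlane :=
  isOpen_lt continuous_const Complex.continuous_re

/-- The functions in the weighted Bergman space of the right half-plane: analytic functions `h` on
the half-plane with `∫∫ x ^ ℓ |h (x + i y)| ^ 2 dx dy < ∞`. A function on the half-plane is
represented by its extension by zero to `ℂ`, so that two elements are equal exactly when they agree
on the half-plane. -/
def bergmanSubmodule (ℓ : ℕ) : Submodule ℂ (ℂ → ℂ) where
  carrier := {h | DifferentiableOn ℂ h rightHalfPlane ∧ (∀ z, z ∉ rightHalfPlane → h z = 0) ∧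
    IntegrableOn (fun z : ℂ => z.re ^ ℓ * ‖h z‖ ^ 2) rightHalfPlane}
  zero_mem' := by
    refine ⟨differentiableOn_const 0, fun _ _ => rfl, ?_⟩
    simp
  add_mem' := by
    rintro f g ⟨hf, hf0, hfi⟩ ⟨hg, hg0, hgi⟩
    refine ⟨hf.add hg, fun z hz => by simp [hf0 z hz, hg0 z hz], ?_⟩
    refine Integrable.mono' ((hfi.add hgi).const_mul 2) ?_ ?_
    · refine ContinuousOn.aestronglyMeasurable ?_ isOpen_rightHalfPlane.measurableSet
      exact (Complex.continuous_re.pow ℓ).continuousOn.mul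
        ((hf.continuousOn.add hg.continuousOn).norm.pow 2)
    · refine (ae_restrict_iff' isOpen_rightHalfPlane.measurableSet).2 (Filter.Eventually.of_forall ?_)
      intro z hz
      have hz' : 0 < z.re := hz
      have h1 : ‖f z + g z‖ ^ 2 ≤ 2 * (‖f z‖ ^ 2 + ‖g z‖ ^ 2) := by
        have h2 := norm_add_le (f z) (g z)
        have h3 := norm_nonneg (f z + g z)
        nlinarith [sq_nonneg (‖f z‖ - ‖g z‖)]
      rw [Real.norm_of_nonneg (by positivity)]
      have h4 : (0 : ℝ) ≤ z.re ^ ℓ := by positivity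
      have := mul_le_mul_of_nonneg_left h1 h4
      simp only [Pi.add_apply]
      linarith
  smul_mem' := by
    rintro a f ⟨hf, hf0, hfi⟩
    refine ⟨hf.const_smul a, fun z hz => by simp [hf0 z hz], ?_⟩
    have := hfi.const_mul (‖a‖ ^ 2)
    refine this.congr (Filter.Eventually.of_forall fun z => ?_)
    simp [mul_pow]
    ring

/-- The weighted Bergman space of the right half-plane, with weight `(Re z) ^ ℓ`. -/
def Bergman (ℓ : ℕ) : Type := bergmanSubmodule ℓ

namespace Bergman

variable {ℓ : ℕ}

instance : AddCommGroup (Bergman ℓ) := inferInstanceAs (AddCommGroup (bergmanSubmodule ℓ))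

instance : Module ℂ (Bergman ℓ) := inferInstanceAs (Module ℂ (bergmanSubmodule ℓ))

instance : FunLike (Bergman ℓ) ℂ ℂ where
  coe h := Subtype.val (p := fun k => k ∈ bergmanSubmodule ℓ) h
  coe_injective := Subtype.val_injective

/-- An element of the Bergman space from a function. -/
def mk (h : ℂ → ℂ) (hh : h ∈ bergmanSubmodule ℓ) : Bergman ℓ := Subtype.mk h hh

@[simp]
theorem coe_mk (h : ℂ → ℂ) (hh : h ∈ bergmanSubmodule ℓ) : (mk h hh : ℂ → ℂ) = h := rfl

theorem coe_mem (h : Bergman ℓ) : (h : ℂ → ℂ) ∈ bergmanSubmodule ℓ :=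
  Subtype.prop (p := fun k => k ∈ bergmanSubmodule ℓ) h

@[simp]
theorem coe_zero : ((0 : Bergman ℓ) : ℂ → ℂ) = 0 := rfl

@[simp]
theorem coe_add (h k : Bergman ℓ) : ((h + k : Bergman ℓ) : ℂ → ℂ) = h + k := rfl

@[simp]
theorem coe_smul (a : ℂ) (h : Bergman ℓ) : ((a • h : Bergman ℓ) : ℂ → ℂ) = a • (h : ℂ → ℂ) := rfl

theorem differentiableOn (h : Bergman ℓ) : DifferentiableOn ℂ h rightHalfPlane := h.coe_mem.1

theorem eq_zero_of_notMem (h : Bergman ℓ) {z : ℂ} (hz : z ∉ rightHalfPlane) : h z = 0 :=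
  h.coe_mem.2.1 z hz

theorem integrableOn (h : Bergman ℓ) :
    IntegrableOn (fun z : ℂ => z.re ^ ℓ * ‖h z‖ ^ 2) rightHalfPlane := h.coe_mem.2.2

theorem ext_fun {h k : Bergman ℓ} (H : ∀ z ∈ rightHalfPlane, h z = k z) : h = k := by
  refine DFunLike.ext' (funext fun z => ?_)
  by_cases hz : z ∈ rightHalfPlane
  · exact H z hz
  · rw [h.eq_zero_of_notMem hz, k.eq_zero_of_notMem hz]

theorem integrableOn_inner (h k : Bergman ℓ) :
    IntegrableOn (fun z : ℂ => ((z.re : ℂ) ^ ℓ) * (conj (h z) * k z)) rightHalfPlane := by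
  refine Integrable.mono' (h.integrableOn.add k.integrableOn) ?_ ?_
  · refine ContinuousOn.aestronglyMeasurable ?_ isOpen_rightHalfPlane.measurableSet
    refine ContinuousOn.mul (by fun_prop) (ContinuousOn.mul ?_ k.differentiableOn.continuousOn)
    exact Complex.continuous_conj.comp_continuousOn h.differentiableOn.continuousOn
  · refine (ae_restrict_iff' isOpen_rightHalfPlane.measurableSet).2 (Filter.Eventually.of_forall ?_)
    intro z hz
    have hz' : 0 < z.re := hz
    simp only [norm_mul, norm_pow, Complex.norm_real, RCLike.norm_conj, Pi.add_apply,
      Real.norm_of_nonneg hz'.le]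
    rw [← mul_add]
    refine mul_le_mul_of_nonneg_left ?_ (by positivity)
    nlinarith [sq_nonneg (‖h z‖ - ‖k z‖), sq_nonneg (‖h z‖ + ‖k z‖)]

/-- The inner product `(1 / π) ∫∫ x ^ ℓ conj (h) k dx dy`, conjugate linear in the first variable
as is the convention of Mathlib. -/
def innerFun (h k : Bergman ℓ) : ℂ :=
  (Real.pi : ℂ)⁻¹ * ∫ z in rightHalfPlane, ((z.re : ℂ) ^ ℓ) * (conj (h z) * k z)

theorem innerFun_self_eq (h : Bergman ℓ) : innerFun h h =
    ((Real.pi⁻¹ * ∫ z in rightHalfPlane, z.re ^ ℓ * ‖h z‖ ^ 2 : ℝ) : ℂ) := by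
  rw [innerFun, Complex.ofReal_mul, ← integral_complex_ofReal, Complex.ofReal_inv]
  congr 2
  funext z
  rw [Complex.conj_mul']
  push_cast
  rfl

theorem integral_nonneg (h : Bergman ℓ) :
    0 ≤ ∫ z in rightHalfPlane, z.re ^ ℓ * ‖h z‖ ^ 2 := by
  refine setIntegral_nonneg isOpen_rightHalfPlane.measurableSet fun z hz => ?_
  have hz' : 0 < z.re := hz
  positivity

theorem eq_zero_of_integral (h : Bergman ℓ)
    (H : ∫ z in rightHalfPlane, z.re ^ ℓ * ‖h z‖ ^ 2 = 0) : h = 0 := by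
  have hae := (setIntegral_eq_zero_iff_of_nonneg_ae
    ((ae_restrict_iff' isOpen_rightHalfPlane.measurableSet).2 (Filter.Eventually.of_forall
      fun z hz => by have hz' : 0 < z.re := hz; simp only [Pi.zero_apply]; positivity))
    h.integrableOn).1 H
  have hc : ContinuousOn (fun z : ℂ => z.re ^ ℓ * ‖h z‖ ^ 2) rightHalfPlane :=
    (Complex.continuous_re.pow ℓ).continuousOn.mul (h.differentiableOn.continuousOn.norm.pow 2)
  have heq := Measure.eqOn_open_of_ae_eq hae isOpen_rightHalfPlane hc continuousOn_const
  refine ext_fun fun z hz => ?_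
  have hz' : 0 < z.re := hz
  have h1 : z.re ^ ℓ * ‖h z‖ ^ 2 = 0 := heq hz
  have h2 : (z.re ^ ℓ) ≠ 0 := by positivity
  have h3 : ‖h z‖ = 0 := by simpa [h2] using h1
  exact norm_eq_zero.1 h3

/-- The inner product axioms. -/
@[reducible]
def innerCore (ℓ : ℕ) : InnerProductSpace.Core ℂ (Bergman ℓ) where
  inner := innerFun
  conj_inner_symm h k := by
    rw [innerFun, innerFun, map_mul, ← integral_conj]
    simp only [map_mul, map_pow, Complex.conj_ofReal, Complex.conj_conj, map_inv₀]
    congr 2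
    funext z
    ring
  re_inner_nonneg h := by
    rw [innerFun_self_eq]
    simp only [RCLike.re_to_complex, Complex.ofReal_re]
    exact mul_nonneg (by positivity) (integral_nonneg h)
  add_left f g h := by
    rw [innerFun, innerFun, innerFun, ← mul_add,
      ← integral_add (integrableOn_inner f h) (integrableOn_inner g h)]
    congr 2
    funext z
    change _ * (conj (f z + g z) * h z) = _
    rw [map_add]
    ring
  smul_left f g a := by
    rw [innerFun, innerFun, mul_left_comm, ← integral_const_mul (conj a)]
    congr 2
    funext z
    change _ * (conj (a * f z) * g z) = _
    rw [map_mul]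
    ring
  definite h H := by
    rw [innerFun_self_eq, Complex.ofReal_eq_zero] at H
    exact eq_zero_of_integral h ((mul_eq_zero.1 H).resolve_left (by positivity))

instance : NormedAddCommGroup (Bergman ℓ) := (innerCore ℓ).toNormedAddCommGroup

instance : InnerProductSpace ℂ (Bergman ℓ) := InnerProductSpace.ofCore (innerCore ℓ).toCore

theorem inner_eq (h k : Bergman ℓ) : inner ℂ h k =
    (Real.pi : ℂ)⁻¹ * ∫ z in rightHalfPlane, ((z.re : ℂ) ^ ℓ) * (conj (h z) * k z) := rfl

theorem norm_sq_eq (h : Bergman ℓ) :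
    ‖h‖ ^ 2 = Real.pi⁻¹ * ∫ z in rightHalfPlane, z.re ^ ℓ * ‖h z‖ ^ 2 := by
  rw [← inner_self_eq_norm_sq (𝕜 := ℂ) h]
  change (innerFun h h).re = _
  rw [innerFun_self_eq, Complex.ofReal_re]

end Bergman

theorem det_restrictScalars_toSpanSingleton (a : ℂ) :
    ((ContinuousLinearMap.toSpanSingleton ℂ a).restrictScalars ℝ : ℂ →L[ℝ] ℂ).det = ‖a‖ ^ 2 := by
  simp [ContinuousLinearMap.det, LinearMap.det_restrictScalars, Algebra.norm_complex_eq,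
    Complex.normSq_eq_norm_sq]

/-! ### The unitary operators `U` -/

theorem image_affine_rightHalfPlane {s : ℝ} (hs : 0 < s) (c : ℝ) :
    (fun z : ℂ => (s : ℂ) * z + Complex.I * c) '' rightHalfPlane = rightHalfPlane := by
  have hs' : (s : ℂ) ≠ 0 := by exact_mod_cast hs.ne'
  ext w
  constructor
  · rintro ⟨z, hz, rfl⟩
    have hz' : 0 < z.re := hz
    simpa [rightHalfPlane] using mul_pos hs hz'
  · intro hw
    have hw' : 0 < w.re := hw
    refine ⟨((s⁻¹ : ℝ) : ℂ) * (w - Complex.I * c), ?_, ?_⟩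
    · change 0 < (((s⁻¹ : ℝ) : ℂ) * (w - Complex.I * c)).re
      rw [Complex.re_ofReal_mul]
      simpa using mul_pos (inv_pos.2 hs) hw'
    · push_cast
      field_simp
      ring

theorem injective_affine {s : ℝ} (hs : 0 < s) (c : ℝ) :
    Function.Injective (fun z : ℂ => (s : ℂ) * z + Complex.I * c) := by
  have hs' : (s : ℂ) ≠ 0 := by exact_mod_cast hs.ne'
  intro z w h
  simpa [hs'] using h

theorem hasFDerivWithinAt_affine (s c : ℝ) (z : ℂ) :
    HasFDerivWithinAt (fun z : ℂ => (s : ℂ) * z + Complex.I * c)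
      ((ContinuousLinearMap.toSpanSingleton ℂ (s : ℂ)).restrictScalars ℝ) rightHalfPlane z := by
  have h : HasDerivAt (fun z : ℂ => (s : ℂ) * z + Complex.I * c) (s : ℂ) z := by
    simpa using ((hasDerivAt_id z).const_mul (s : ℂ)).add_const (Complex.I * c)
  exact (h.hasFDerivAt.restrictScalars ℝ).hasFDerivWithinAt

namespace Bergman

variable {ℓ : ℕ}

theorem affine_weight (h : ℂ → ℂ) (s c : ℝ) (z : ℂ) :
    |((ContinuousLinearMap.toSpanSingleton ℂ (s : ℂ)).restrictScalars ℝ : ℂ →L[ℝ] ℂ).det| •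
      (((s : ℂ) * z + Complex.I * c).re ^ ℓ * ‖h ((s : ℂ) * z + Complex.I * c)‖ ^ 2) =
    s ^ (ℓ + 2) * (z.re ^ ℓ * ‖h ((s : ℂ) * z + Complex.I * c)‖ ^ 2) := by
  rw [det_restrictScalars_toSpanSingleton]
  have : ((s : ℂ) * z + Complex.I * c).re = s * z.re := by simp
  rw [this, Complex.norm_real, Real.norm_eq_abs, sq_abs, abs_of_nonneg (sq_nonneg s), smul_eq_mul,
    mul_pow]
  ring

/-- The operator `h ↦ a h (s z + i c)`, which is isometric when `|a| ^ 2 = s ^ (ℓ + 2)`. -/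
def affineIsometry (a : ℂ) (s c : ℝ) (hs : 0 < s) (ha : ‖a‖ ^ 2 = s ^ (ℓ + 2)) :
    Bergman ℓ →ₗᵢ[ℂ] Bergman ℓ where
  toFun h := mk (fun z => a * h ((s : ℂ) * z + Complex.I * c)) <| by
    refine ⟨?_, ?_, ?_⟩
    · refine DifferentiableOn.const_mul ?_ a
      refine h.differentiableOn.comp (by fun_prop) ?_
      intro z hz
      rw [← image_affine_rightHalfPlane hs c]
      exact mem_image_of_mem _ hz
    · intro z hz
      change a * h _ = 0
      rw [h.eq_zero_of_notMem, mul_zero]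
      intro hw
      rw [← image_affine_rightHalfPlane hs c] at hw
      exact hz ((injective_affine hs c).mem_set_image.1 hw)
    · have key := h.integrableOn
      rw [← image_affine_rightHalfPlane hs c,
        integrableOn_image_iff_integrableOn_abs_det_fderiv_smul volume
          isOpen_rightHalfPlane.measurableSet (fun z _ => hasFDerivWithinAt_affine s c z)
          (injective_affine hs c).injOn] at key
      simp only [affine_weight] at key
      refine key.congr (Filter.Eventually.of_forall fun z => ?_)
      simp only [norm_mul, mul_pow, ha]
      ring
  map_add' h k := DFunLike.ext' (funext fun z => mul_add a _ _)
  map_smul' r h := DFunLike.ext' (funext fun z => mul_left_comm a r _)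
  norm_map' h := by
    refine (sq_eq_sq₀ (norm_nonneg _) (norm_nonneg _)).1 ?_
    rw [norm_sq_eq, norm_sq_eq]
    congr 1
    conv_rhs => rw [← image_affine_rightHalfPlane hs c]
    rw [integral_image_eq_integral_abs_det_fderiv_smul volume
          isOpen_rightHalfPlane.measurableSet (fun z _ => hasFDerivWithinAt_affine s c z)
          (injective_affine hs c).injOn]
    simp only [affine_weight]
    congr 1
    funext z
    change _ * ‖a * h _‖ ^ 2 = _
    rw [norm_mul, mul_pow, ha]
    ring

end Bergman

/-- The dilation factor `|b| ^ (2 / (ℓ + 2))`. -/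
def dil (ℓ : ℕ) (b : ℂ) : ℝ := ‖b‖ ^ ((2 : ℝ) / ((ℓ : ℝ) + 2))

theorem dil_pos (ℓ : ℕ) {b : ℂ} (hb : b ≠ 0) : 0 < dil ℓ b :=
  Real.rpow_pos_of_pos (norm_pos_iff.2 hb) _

theorem dil_pow (ℓ : ℕ) (b : ℂ) : ‖b‖ ^ 2 = dil ℓ b ^ (ℓ + 2) := by
  rw [dil, ← Real.rpow_natCast (‖b‖ ^ _), ← Real.rpow_mul (norm_nonneg b)]
  have : (2 : ℝ) / ((ℓ : ℝ) + 2) * ((ℓ + 2 : ℕ) : ℝ) = (2 : ℕ) := by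
    push_cast
    field_simp
  rw [this, Real.rpow_natCast]

/-- The unitary operator `U h (z) = b h (|b| ^ (2 / (ℓ + 2)) z + i c)`; its adjoint is its inverse
`bergmanU.symm`. -/
def bergmanU (ℓ : ℕ) (b : ℂ) (hb : b ≠ 0) (c : ℝ) : Bergman ℓ ≃ₗᵢ[ℂ] Bergman ℓ where
  toFun := Bergman.affineIsometry b (dil ℓ b) c (dil_pos ℓ hb) (dil_pow ℓ b)
  map_add' := map_add _
  map_smul' := map_smul _
  norm_map' := LinearIsometry.norm_map _
  invFun := Bergman.affineIsometry b⁻¹ (dil ℓ b)⁻¹ (-(dil ℓ b)⁻¹ * c) (inv_pos.2 (dil_pos ℓ hb)) (by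
    rw [norm_inv, inv_pow, inv_pow, dil_pow])
  left_inv h := by
    have h1 : (dil ℓ b : ℂ) ≠ 0 := by exact_mod_cast (dil_pos ℓ hb).ne'
    refine DFunLike.ext' (funext fun z => ?_)
    change b⁻¹ * (b * h _) = h z
    rw [← mul_assoc, inv_mul_cancel₀ hb, one_mul]
    congr 1
    push_cast
    rw [mul_add, mul_inv_cancel_left₀ h1]
    linear_combination (-Complex.I * c) * mul_inv_cancel₀ h1
  right_inv h := by
    have h1 : (dil ℓ b : ℂ) ≠ 0 := by exact_mod_cast (dil_pos ℓ hb).ne'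
    refine DFunLike.ext' (funext fun z => ?_)
    change b * (b⁻¹ * h _) = h z
    rw [← mul_assoc, mul_inv_cancel₀ hb, one_mul]
    congr 1
    push_cast
    field_simp
    ring

theorem bergmanU_apply (ℓ : ℕ) (b : ℂ) (hb : b ≠ 0) (c : ℝ) (h : Bergman ℓ) (z : ℂ) :
    bergmanU ℓ b hb c h z = b * h ((dil ℓ b : ℂ) * z + Complex.I * c) := rfl

theorem bergmanU_symm_apply (ℓ : ℕ) (b : ℂ) (hb : b ≠ 0) (c : ℝ) (h : Bergman ℓ) (z : ℂ) :
    (bergmanU ℓ b hb c).symm h z = b⁻¹ * h ((dil ℓ b : ℂ)⁻¹ * (z - Complex.I * c)) := by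
  change b⁻¹ * h _ = _
  congr 2
  push_cast
  ring

theorem inner_bergmanU_left (ℓ : ℕ) (b : ℂ) (hb : b ≠ 0) (c : ℝ) (h k : Bergman ℓ) :
    inner ℂ (bergmanU ℓ b hb c h) k = inner ℂ h ((bergmanU ℓ b hb c).symm k) := by
  rw [← LinearIsometryEquiv.inner_map_map (bergmanU ℓ b hb c) h, LinearIsometryEquiv.apply_symm_apply]

/-! ### The conjugation `C⋆` -/

theorem star_mem_rightHalfPlane_iff (z : ℂ) : 1 / conj z ∈ rightHalfPlane ↔ z ∈ rightHalfPlane := by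
  change 0 < (1 / conj z).re ↔ 0 < z.re
  rw [one_div, Complex.inv_re, Complex.conj_re, Complex.normSq_conj]
  constructor
  · intro h
    by_contra h0
    exact absurd h (not_lt.2 (div_nonpos_of_nonpos_of_nonneg (not_lt.1 h0) (Complex.normSq_nonneg z)))
  · intro h
    refine div_pos h (Complex.normSq_pos.2 ?_)
    rintro rfl
    simp at h

theorem ne_zero_of_mem_rightHalfPlane {z : ℂ} (hz : z ∈ rightHalfPlane) : z ≠ 0 := by
  rintro rfl
  simp [rightHalfPlane] at hz

theorem star_star_eq (z : ℂ) : 1 / conj (1 / conj z) = z := by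
  simp

theorem image_star_rightHalfPlane :
    (fun z : ℂ => 1 / conj z) '' rightHalfPlane = rightHalfPlane := by
  ext w
  constructor
  · rintro ⟨z, hz, rfl⟩
    exact (star_mem_rightHalfPlane_iff z).2 hz
  · intro hw
    exact ⟨1 / conj w, (star_mem_rightHalfPlane_iff w).2 hw, star_star_eq w⟩

theorem injective_star : Function.Injective (fun z : ℂ => 1 / conj z) := by
  intro z w h
  have h' : 1 / conj z = 1 / conj w := h
  rw [← star_star_eq z, h', star_star_eq]

/-- The real derivative of `z ↦ 1 / conj z`. -/
def starFDeriv (z : ℂ) : ℂ →L[ℝ] ℂ :=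
  (Complex.conjCLE : ℂ →L[ℝ] ℂ) ∘L
    ((ContinuousLinearMap.toSpanSingleton ℂ (-(z ^ 2)⁻¹)).restrictScalars ℝ)

theorem hasFDerivWithinAt_star {z : ℂ} (hz : z ∈ rightHalfPlane) :
    HasFDerivWithinAt (fun z : ℂ => 1 / conj z) (starFDeriv z) rightHalfPlane z := by
  have h1 := ((hasDerivAt_inv (ne_zero_of_mem_rightHalfPlane hz)).hasFDerivAt.restrictScalars ℝ)
  have h2 := (Complex.conjCLE : ℂ →L[ℝ] ℂ).hasFDerivAt (x := z⁻¹)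
  have h3 := (h2.comp z h1).hasFDerivWithinAt (s := rightHalfPlane)
  refine h3.congr (fun w _ => ?_) ?_ <;> simp

theorem abs_det_starFDeriv (z : ℂ) : |(starFDeriv z).det| = (‖z‖ ^ 4)⁻¹ := by
  have h1 : (starFDeriv z).det = (Complex.conjCLE : ℂ →L[ℝ] ℂ).det *
      ((ContinuousLinearMap.toSpanSingleton ℂ (-(z ^ 2)⁻¹)).restrictScalars ℝ : ℂ →L[ℝ] ℂ).det :=
    LinearMap.det_comp _ _
  have h2 : (Complex.conjCLE : ℂ →L[ℝ] ℂ).det = -1 := Complex.det_conjAe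
  rw [h1, h2, det_restrictScalars_toSpanSingleton, norm_neg, norm_inv, norm_pow, neg_one_mul, abs_neg,
    abs_of_nonneg (by positivity), inv_pow, ← pow_mul]

namespace Bergman

variable {ℓ : ℕ}

theorem star_weight (h : ℂ → ℂ) {z : ℂ} (hz : z ∈ rightHalfPlane) :
    |(starFDeriv z).det| • ((1 / conj z).re ^ ℓ * ‖h (1 / conj z)‖ ^ 2) =
      z.re ^ ℓ * ‖1 / z ^ (ℓ + 2) * conj (h (1 / conj z))‖ ^ 2 := by
  have hz0 : ‖z‖ ≠ 0 := norm_ne_zero_iff.2 (ne_zero_of_mem_rightHalfPlane hz)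
  have hre : (1 / conj z).re = z.re / ‖z‖ ^ 2 := by
    rw [one_div, Complex.inv_re, Complex.conj_re, Complex.normSq_conj, Complex.normSq_eq_norm_sq]
  rw [abs_det_starFDeriv, hre, norm_mul, RCLike.norm_conj, norm_div, norm_one, norm_pow, smul_eq_mul,
    div_pow, mul_pow, div_pow, one_pow]
  have h4 : (‖z‖ ^ (ℓ + 2)) ^ 2 = ‖z‖ ^ 4 * (‖z‖ ^ 2) ^ ℓ := by ring
  rw [h4]
  field_simp

/-- The function `C⋆ h (z) = z ^ (-(ℓ + 2)) conj (h (1 / conj z))` as an element of the space. -/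
def starFun (h : Bergman ℓ) : Bergman ℓ :=
  mk (fun z => 1 / z ^ (ℓ + 2) * conj (h (1 / conj z))) <| by
    refine ⟨?_, ?_, ?_⟩
    · intro z hz
      have hz0 := ne_zero_of_mem_rightHalfPlane hz
      refine DifferentiableAt.differentiableWithinAt ?_
      refine DifferentiableAt.mul
        ((differentiableAt_const _).div (by fun_prop) (pow_ne_zero _ hz0)) ?_
      have hw : DifferentiableAt ℂ h (conj (z⁻¹)) := by
        refine h.differentiableOn.differentiableAt (isOpen_rightHalfPlane.mem_nhds ?_)
        simpa using (star_mem_rightHalfPlane_iff z).2 hz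
      have h1 : DifferentiableAt ℂ (conj ∘ h ∘ conj) z⁻¹ := by
        simpa using hw.conj_conj
      have h2 := DifferentiableAt.comp z h1 (differentiableAt_inv hz0)
      refine h2.congr_of_eventuallyEq (Filter.Eventually.of_forall fun w => ?_)
      simp
    · intro z hz
      change _ * conj (h _) = 0
      rw [h.eq_zero_of_notMem (fun hw => hz ((star_mem_rightHalfPlane_iff z).1 hw)), map_zero, mul_zero]
    · have key := h.integrableOn
      rw [← image_star_rightHalfPlane,
        integrableOn_image_iff_integrableOn_abs_det_fderiv_smul volume
          isOpen_rightHalfPlane.measurableSet (fun z hz => hasFDerivWithinAt_star hz)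
          injective_star.injOn] at key
      exact key.congr_fun (fun z hz => star_weight h hz) isOpen_rightHalfPlane.measurableSet

theorem norm_starFun (h : Bergman ℓ) : ‖starFun h‖ = ‖h‖ := by
  refine (sq_eq_sq₀ (norm_nonneg _) (norm_nonneg _)).1 ?_
  rw [norm_sq_eq, norm_sq_eq]
  congr 1
  conv_rhs => rw [← image_star_rightHalfPlane]
  rw [integral_image_eq_integral_abs_det_fderiv_smul volume
    isOpen_rightHalfPlane.measurableSet (fun z hz => hasFDerivWithinAt_star hz)
    injective_star.injOn]
  exact setIntegral_congr_fun isOpen_rightHalfPlane.measurableSet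
    (fun z hz => (star_weight h hz).symm)

theorem starFun_starFun (h : Bergman ℓ) : starFun (starFun h) = h := by
  refine ext_fun fun z hz => ?_
  have hz0 := ne_zero_of_mem_rightHalfPlane hz
  change 1 / z ^ (ℓ + 2) * conj (1 / (1 / conj z) ^ (ℓ + 2) * conj (h (1 / conj (1 / conj z)))) = _
  rw [star_star_eq]
  simp only [one_div, inv_pow, inv_inv, map_mul, map_pow, Complex.conj_conj]
  rw [← mul_assoc, inv_mul_cancel₀ (pow_ne_zero _ hz0), one_mul]

end Bergman

/-- The conjugation `C⋆ h (z) = z ^ (-(ℓ + 2)) conj (h (1 / conj z))`: an antilinear isometry which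
is its own inverse. -/
def bergmanC (ℓ : ℕ) : Bergman ℓ ≃ₗᵢ⋆[ℂ] Bergman ℓ where
  toFun := Bergman.starFun
  map_add' h k := DFunLike.ext' (funext fun z => by
    change 1 / z ^ (ℓ + 2) * conj (h _ + k _) = _
    rw [map_add, mul_add]
    rfl)
  map_smul' r h := DFunLike.ext' (funext fun z => by
    change 1 / z ^ (ℓ + 2) * conj (r * h _) = _
    rw [map_mul, mul_left_comm]
    rfl)
  norm_map' := Bergman.norm_starFun
  invFun := Bergman.starFun
  left_inv := Bergman.starFun_starFun
  right_inv := Bergman.starFun_starFun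

theorem bergmanC_apply (ℓ : ℕ) (h : Bergman ℓ) (z : ℂ) :
    bergmanC ℓ h z = 1 / z ^ (ℓ + 2) * conj (h (1 / conj z)) := rfl

/-- The conjugation `U C⋆ U*`. -/
def bergmanUCU (ℓ : ℕ) (b : ℂ) (hb : b ≠ 0) (c : ℝ) : Bergman ℓ ≃ₗᵢ⋆[ℂ] Bergman ℓ :=
  ((bergmanU ℓ b hb c).symm.trans (bergmanC ℓ)).trans (bergmanU ℓ b hb c)

theorem bergmanUCU_apply (ℓ : ℕ) (b : ℂ) (hb : b ≠ 0) (c : ℝ) (h : Bergman ℓ) :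
    bergmanUCU ℓ b hb c h = bergmanU ℓ b hb c (bergmanC ℓ ((bergmanU ℓ b hb c).symm h)) := rfl

theorem bergmanUCU_involutive (ℓ : ℕ) (b : ℂ) (hb : b ≠ 0) (c : ℝ) :
    Function.Involutive (bergmanUCU ℓ b hb c) := by
  intro h
  rw [bergmanUCU_apply, bergmanUCU_apply, LinearIsometryEquiv.symm_apply_apply]
  have : bergmanC ℓ (bergmanC ℓ ((bergmanU ℓ b hb c).symm h)) = (bergmanU ℓ b hb c).symm h :=
    Bergman.starFun_starFun _
  rw [this, LinearIsometryEquiv.apply_symm_apply]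

/-! ### Unbounded operators -/

section Operators

variable {E : Type*} [NormedAddCommGroup E] [InnerProductSpace ℂ E]

/-- `T` is selfadjoint with respect to the conjugation `J`: `T` is densely defined and
`T = J T* J`, with equality of domains. The adjoint `T*` of the densely defined operator `T` is
given by its graph `T.graph.adjoint`, the set of all pairs `(y, w)` with `⟪T x, y⟫ = ⟪x, w⟫` for
all `x` in the domain of `T`. -/
def IsConjSelfAdjoint (J : E ≃ₗᵢ⋆[ℂ] E) (T : E →ₗ.[ℂ] E) : Prop :=
  Dense (T.domain : Set E) ∧
    ∀ u v : E, (u, v) ∈ T.graph ↔ ∃ w : E, (J u, w) ∈ T.graph.adjoint ∧ v = J w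

/-- `T` is bounded: it is everywhere defined and `‖T x‖ ≤ L ‖x‖` for some constant `L`. -/
def IsBoundedPMap (T : E →ₗ.[ℂ] E) : Prop :=
  T.domain = ⊤ ∧ ∃ L : ℝ, 0 < L ∧ ∀ x : T.domain, ‖T x‖ ≤ L * ‖(x : E)‖

/-- The operator `U* T U`, with domain the set of all `x` such that `U x` is in the domain
of `T`. -/
def unitaryConj (U : E ≃ₗᵢ[ℂ] E) (T : E →ₗ.[ℂ] E) : E →ₗ.[ℂ] E where
  domain := T.domain.comap (U.toLinearEquiv : E →ₗ[ℂ] E)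
  toFun :=
    { toFun := fun x => U.symm (T ⟨U x, x.2⟩)
      map_add' := fun x y => by
        rw [← map_add, ← LinearPMap.map_add]
        congr 2
        exact Subtype.ext (map_add U (x : E) (y : E))
      map_smul' := fun r x => by
        rw [RingHom.id_apply, ← map_smul, ← LinearPMap.map_smul]
        congr 2
        exact Subtype.ext (map_smul U r (x : E)) }

end Operators

/-! ### Maximal weighted composition operators -/

/-- The weighted composition expression `f · h ∘ g` on the right half-plane, extended by zero. -/
def wcoExpr (f g h : ℂ → ℂ) : ℂ → ℂ := rightHalfPlane.indicator fun z => f z * h (g z)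

theorem wcoExpr_add (f g h k : ℂ → ℂ) : wcoExpr f g (h + k) = wcoExpr f g h + wcoExpr f g k := by
  rw [wcoExpr, wcoExpr, wcoExpr, ← Set.indicator_add']
  congr 1
  funext z
  exact mul_add _ _ _

theorem wcoExpr_smul (f g : ℂ → ℂ) (r : ℂ) (h : ℂ → ℂ) : wcoExpr f g (r • h) = r • wcoExpr f g h := by
  funext z
  by_cases hz : z ∈ rightHalfPlane
  · simp [wcoExpr, hz, mul_left_comm]
  · simp [wcoExpr, hz]

/-- The maximal weighted composition operator `h ↦ f · h ∘ g`, with domain the set of all `h` in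
the Bergman space such that `f · h ∘ g` is in the Bergman space. -/
def wcoMax (ℓ : ℕ) (f g : ℂ → ℂ) : Bergman ℓ →ₗ.[ℂ] Bergman ℓ where
  domain :=
    { carrier := {h : Bergman ℓ | wcoExpr f g h ∈ bergmanSubmodule ℓ}
      zero_mem' := by
        have h0 := wcoExpr_smul f g 0 0
        rw [zero_smul, zero_smul] at h0
        rw [mem_ofPred_eq, Bergman.coe_zero, h0]
        exact Submodule.zero_mem _
      add_mem' := fun {h k} hh hk => by
        rw [mem_ofPred_eq, Bergman.coe_add, wcoExpr_add]
        exact Submodule.add_mem _ hh hk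
      smul_mem' := fun r h hh => by
        rw [mem_ofPred_eq, Bergman.coe_smul, wcoExpr_smul]
        exact Submodule.smul_mem _ r hh }
  toFun :=
    { toFun := fun h => Bergman.mk (wcoExpr f g (h : Bergman ℓ)) h.2
      map_add' := fun h k => DFunLike.ext' (wcoExpr_add f g (h : Bergman ℓ) (k : Bergman ℓ))
      map_smul' := fun r h => DFunLike.ext' (wcoExpr_smul f g r (h : Bergman ℓ)) }

theorem mem_wcoMax_domain (ℓ : ℕ) (f g : ℂ → ℂ) (h : Bergman ℓ) :
    h ∈ (wcoMax ℓ f g).domain ↔ wcoExpr f g h ∈ bergmanSubmodule ℓ := Iff.rfl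

theorem wcoMax_apply (ℓ : ℕ) (f g : ℂ → ℂ) (h : (wcoMax ℓ f g).domain) :
    (wcoMax ℓ f g h : ℂ → ℂ) = wcoExpr f g (h : Bergman ℓ) := rfl

end

/-! Write T for the maximal operator and K_w(z) = 2^ℓ (ℓ+1) / (z + conj w)^(ℓ+2) for the reproducing
kernel, so that ⟪K_w, h⟫ = h(w). Then T* K_w = conj (f w) K_{g w}, while C⋆ K_w(z) is a constant
times (1 + z w)^-(ℓ+2). Hence C⋆-selfadjointness forces f(z) (1 + z g(w))^(ℓ+2) = f(w) (1 + w
g(z))^(ℓ+2) (`IsConjSelfAdjoint.kernel_symm`).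

Unless f vanishes, differentiating this identity in z at z = 1 and eliminating f(w) leaves a
relation linear in g(w). So g(w) = (p + q w) / (t + p w), with a symmetric coefficient matrix, and f
is a multiple of (t + p w)^-(ℓ+2) (`exists_moebius_of_kernel_symm`). The case p = 0 gives the
dilations. The case p ≠ 0 gives (c), whose inequalities say that g preserves the half-plane; the
constant symbols of (a) reappear there as δκ = 1.

Conversely, every listed symbol satisfies the identity and gives a bounded operator: a constant g
gives rank at most one, and an injective g is handled by a change of variables together with the
Schwarz–Pick inequality |g'(w)| Re w ≤ Re g(w) (`MoebiusCond.norm_mul_re_le`). Boundedness makes T*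
everywhere defined, and testing it against the functions C⋆ K_z yields T = C⋆ T* C⋆
(`isConjSelfAdjoint_of_bounded`). General b and c reduce to this case by conjugation with U, which
acts on symbols by an affine change of variable. -/

/-! ### Weighted mean value property on the disc -/

theorem integral_radial_weight (ℓ : ℕ) :
    ∫ r in (0 : ℝ)..1, r * (1 - r ^ 2) ^ ℓ = 1 / (2 * ((ℓ : ℝ) + 1)) := by
  have hd : ∀ x ∈ uIcc (0 : ℝ) 1,
      HasDerivAt (fun r : ℝ => -(1 - r ^ 2) ^ (ℓ + 1) / (2 * ((ℓ : ℝ) + 1)))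
        (x * (1 - x ^ 2) ^ ℓ) x := by
    intro x _
    have h1 : HasDerivAt (fun r : ℝ => 1 - r ^ 2) (-(2 * x)) x := by
      simpa using (hasDerivAt_pow 2 x).const_sub 1
    have h2 := ((h1.pow (ℓ + 1)).neg).div_const (2 * ((ℓ : ℝ) + 1))
    have h3 : (ℓ : ℝ) + 1 ≠ 0 := by positivity
    refine h2.congr_deriv ?_
    push_cast
    field_simp
  rw [intervalIntegral.integral_eq_sub_of_hasDerivAt hd
    (Continuous.intervalIntegrable (by fun_prop) _ _)]
  have h3 : (ℓ : ℝ) + 1 ≠ 0 := by positivity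
  simp
  field_simp

theorem integral_circle_eq {G : ℂ → ℂ} (hG : DifferentiableOn ℂ G (Metric.ball 0 1)) {r : ℝ}
    (hr0 : 0 < r) (hr1 : r < 1) :
    ∫ θ in Ioo (-Real.pi) Real.pi, G (Complex.polarCoord.symm (r, θ)) = 2 * Real.pi * G 0 := by
  have hsub : closure (Metric.ball (0 : ℂ) |r|) ⊆ Metric.ball 0 1 := by
    refine Metric.closure_ball_subset_closedBall.trans ?_
    rw [abs_of_pos hr0]
    exact Metric.closedBall_subset_ball hr1
  have h1 : Real.circleAverage G 0 r = G 0 :=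
    DiffContOnCl.circleAverage (hG.mono hsub).diffContOnCl
  rw [Real.circleAverage] at h1
  -- Circle averages run over [0, 2π] but polar angles over (-π, π); periodicity moves the interval.
  have hper : Function.Periodic (fun θ => G (circleMap 0 r θ)) (2 * Real.pi) :=
    (periodic_circleMap 0 r).comp G
  have h2 := hper.intervalIntegral_add_eq 0 (-Real.pi)
  rw [zero_add, show -Real.pi + 2 * Real.pi = Real.pi by ring] at h2
  rw [← integral_Ioc_eq_integral_Ioo,
    ← intervalIntegral.integral_of_le (by linarith [Real.pi_pos])]
  have h3 : ∀ θ : ℝ, Complex.polarCoord.symm (r, θ) = circleMap 0 r θ := by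
    intro θ
    simp [Complex.polarCoord_symm_apply, circleMap, Complex.exp_mul_I]
  simp only [h3]
  rw [← h2, ← h1]
  have : (Real.pi : ℂ) ≠ 0 := by exact_mod_cast Real.pi_ne_zero
  rw [Complex.real_smul]
  push_cast
  field_simp

/-- Supplies the integrability that Fubini needs in polar coordinates. -/
theorem integrableOn_polarCoord_symm {F : ℂ → ℂ} (hF : Integrable F) :
    IntegrableOn (fun p : ℝ × ℝ => p.1 • F (Complex.polarCoord.symm p)) polarCoord.target := by
  have h1 : Integrable (F ∘ Complex.measurableEquivRealProd.symm) :=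
    (Complex.volume_preserving_equiv_real_prod.symm).integrable_comp_of_integrable hF
  have h2 := (integrableOn_image_iff_integrableOn_abs_det_fderiv_smul volume
    polarCoord.open_target.measurableSet
    (fun p _ => (hasFDerivAt_polarCoord_symm p).hasFDerivWithinAt)
    polarCoord.symm.injOn (F ∘ Complex.measurableEquivRealProd.symm)).1 h1.integrableOn
  refine h2.congr_fun (fun p hp => ?_) polarCoord.open_target.measurableSet
  have hp' : 0 < p.1 := hp.1
  simp only [det_fderivPolarCoordSymm, abs_of_pos hp', Function.comp,
    Complex.measurableEquivRealProd_symm_polarCoord_symm_apply]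

/-- The weighted area mean value property on the unit disc. -/
theorem integral_ball_weight_mul (ℓ : ℕ) {G : ℂ → ℂ}
    (hG : DifferentiableOn ℂ G (Metric.ball 0 1))
    (hi : IntegrableOn (fun ζ : ℂ => ((1 - ‖ζ‖ ^ 2 : ℝ) : ℂ) ^ ℓ * G ζ) (Metric.ball 0 1)) :
    ∫ ζ in Metric.ball (0 : ℂ) 1, ((1 - ‖ζ‖ ^ 2 : ℝ) : ℂ) ^ ℓ * G ζ =
      Real.pi / ((ℓ : ℂ) + 1) * G 0 := by
  set F : ℂ → ℂ := fun ζ => ((1 - ‖ζ‖ ^ 2 : ℝ) : ℂ) ^ ℓ * G ζ with hF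
  have hi' : Integrable ((Metric.ball (0 : ℂ) 1).indicator F) :=
    (integrable_indicator_iff measurableSet_ball).2 hi
  rw [← integral_indicator measurableSet_ball, ← Complex.integral_comp_polarCoord_symm]
  have h1 := integrableOn_polarCoord_symm hi'
  rw [polarCoord_target] at h1 ⊢
  rw [Measure.volume_eq_prod, setIntegral_prod _ h1]
  -- For r < 1 the angular integral is 2π G(0) by the mean value property, whatever the radial
  -- weight; for r ≥ 1 the integrand is zero.
  have h2 : ∀ r ∈ Ioi (0 : ℝ), (∫ θ in Ioo (-Real.pi) Real.pi,
      r • (Metric.ball (0 : ℂ) 1).indicator F (Complex.polarCoord.symm (r, θ))) =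
      (Iio (1 : ℝ)).indicator (fun r => ((r * (1 - r ^ 2) ^ ℓ : ℝ) : ℂ) * (2 * Real.pi * G 0)) r := by
    intro r hr
    have hr0 : 0 < r := hr
    by_cases hr1 : r < 1
    · rw [indicator_of_mem (show r ∈ Iio 1 from hr1), ← integral_circle_eq hG hr0 hr1,
        ← integral_const_mul]
      congr 1
      funext θ
      have hn : ‖Complex.polarCoord.symm (r, θ)‖ = r := by
        rw [Complex.norm_polarCoord_symm, abs_of_pos hr0]
      rw [indicator_of_mem (mem_ball_zero_iff.2 (hn.trans_lt hr1)), Complex.real_smul]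
      simp only [hF, hn]
      push_cast
      ring
    · rw [indicator_of_notMem (show r ∉ Iio 1 from hr1)]
      refine integral_eq_zero_of_ae (Filter.Eventually.of_forall fun θ => ?_)
      have hn : ‖Complex.polarCoord.symm (r, θ)‖ = r := by
        rw [Complex.norm_polarCoord_symm, abs_of_pos hr0]
      simp only [Pi.zero_apply]
      rw [indicator_of_notMem (fun hm => hr1 (hn ▸ mem_ball_zero_iff.1 hm)), smul_zero]
  rw [setIntegral_congr_fun measurableSet_Ioi h2, setIntegral_indicator measurableSet_Iio,
    Ioi_inter_Iio, ← integral_Ioc_eq_integral_Ioo,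
    ← intervalIntegral.integral_of_le zero_le_one, intervalIntegral.integral_mul_const,
    intervalIntegral.integral_ofReal, integral_radial_weight]
  have : (ℓ : ℂ) + 1 ≠ 0 := by exact_mod_cast Nat.succ_ne_zero ℓ
  push_cast
  field_simp

/-! ### The Cayley transform -/

/-- The Cayley transform from the unit disc to the right half-plane. -/
noncomputable def cayley (ζ : ℂ) : ℂ := (1 + ζ) / (1 - ζ)

theorem one_sub_ne_zero_of_mem_ball {ζ : ℂ} (hζ : ζ ∈ Metric.ball (0 : ℂ) 1) : 1 - ζ ≠ 0 := by
  intro h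
  rw [mem_ball_zero_iff, ← sub_eq_zero.1 h, norm_one] at hζ
  exact lt_irrefl _ hζ

theorem cayley_re (ζ : ℂ) : (cayley ζ).re = (1 - ‖ζ‖ ^ 2) / ‖1 - ζ‖ ^ 2 := by
  rw [cayley, Complex.div_re, ← Complex.normSq_eq_norm_sq, ← Complex.normSq_eq_norm_sq, ← add_div]
  congr 1
  simp [Complex.normSq_apply]
  ring

theorem cayley_mem {ζ : ℂ} (hζ : ζ ∈ Metric.ball (0 : ℂ) 1) : cayley ζ ∈ rightHalfPlane := by
  have h1 := norm_pos_iff.2 (one_sub_ne_zero_of_mem_ball hζ)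
  have h2 : ‖ζ‖ < 1 := mem_ball_zero_iff.1 hζ
  change 0 < (cayley ζ).re
  rw [cayley_re]
  have : ‖ζ‖ ^ 2 < 1 := by nlinarith [norm_nonneg ζ]
  have : 0 < 1 - ‖ζ‖ ^ 2 := by linarith
  positivity

/-- Exhibits the map as an affine function of 1/(1 - ζ): this gives injectivity and turns powers of
z + 1 into powers of 1 - ζ. -/
theorem cayley_add_one {ζ : ℂ} (hζ : ζ ∈ Metric.ball (0 : ℂ) 1) :
    cayley ζ + 1 = 2 / (1 - ζ) := by
  have := one_sub_ne_zero_of_mem_ball hζ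
  rw [cayley]
  field_simp
  ring

theorem image_cayley : cayley '' Metric.ball 0 1 = rightHalfPlane := by
  ext w
  constructor
  · rintro ⟨ζ, hζ, rfl⟩
    exact cayley_mem hζ
  · intro hw
    have hw' : 0 < w.re := hw
    have h1 : w + 1 ≠ 0 := by
      intro h
      have := congrArg Complex.re h
      simp at this
      linarith
    refine ⟨(w - 1) / (w + 1), ?_, ?_⟩
    · rw [mem_ball_zero_iff, norm_div, div_lt_one (norm_pos_iff.2 h1)]
      refine lt_of_pow_lt_pow_left₀ 2 (norm_nonneg _) ?_
      rw [← Complex.normSq_eq_norm_sq, ← Complex.normSq_eq_norm_sq]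
      simp [Complex.normSq_apply]
      nlinarith
    · rw [cayley]
      have h2 : 1 + (w - 1) / (w + 1) = 2 * w / (w + 1) := by field_simp; ring
      have h3 : 1 - (w - 1) / (w + 1) = 2 / (w + 1) := by field_simp; ring
      rw [h2, h3]
      field_simp

theorem injOn_cayley : InjOn cayley (Metric.ball 0 1) := by
  intro ζ hζ ξ hξ h
  have h1 : 2 / (1 - ζ) = 2 / (1 - ξ) := by rw [← cayley_add_one hζ, ← cayley_add_one hξ, h]
  rw [div_eq_div_iff (one_sub_ne_zero_of_mem_ball hζ) (one_sub_ne_zero_of_mem_ball hξ)] at h1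
  linear_combination h1 / 2

theorem hasDerivAt_cayley {ζ : ℂ} (hζ : ζ ∈ Metric.ball (0 : ℂ) 1) :
    HasDerivAt cayley (2 / (1 - ζ) ^ 2) ζ := by
  have h0 := one_sub_ne_zero_of_mem_ball hζ
  have h1 : HasDerivAt (fun ζ : ℂ => 1 + ζ) 1 ζ := (hasDerivAt_id ζ).const_add 1
  have h2 : HasDerivAt (fun ζ : ℂ => 1 - ζ) (-1) ζ := (hasDerivAt_id ζ).const_sub 1
  refine (h1.div h2 h0).congr_deriv ?_
  ring

theorem HasDerivAt.hasFDerivWithinAt_real {φ : ℂ → ℂ} {a z : ℂ} {s : Set ℂ}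
    (h : HasDerivAt φ a z) :
    HasFDerivWithinAt φ ((ContinuousLinearMap.toSpanSingleton ℂ a).restrictScalars ℝ) s z :=
  (h.hasFDerivAt.restrictScalars ℝ).hasFDerivWithinAt

/-- The half-plane weight becomes the disc weight up to |1 - ζ|^(-2(ℓ+2)). This factor is the
product of (1 - ζ)^-(ℓ+2) and its conjugate, which is what lets the kernel at 1 cancel the
antiholomorphic half. -/
theorem abs_det_cayley_mul_re_pow (ℓ : ℕ) {ζ : ℂ} (hζ : ζ ∈ Metric.ball (0 : ℂ) 1) :
    |((ContinuousLinearMap.toSpanSingleton ℂ (2 / (1 - ζ) ^ 2)).restrictScalars ℝ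
      : ℂ →L[ℝ] ℂ).det| * (cayley ζ).re ^ ℓ =
      4 * (1 - ‖ζ‖ ^ 2) ^ ℓ / (‖1 - ζ‖ ^ (ℓ + 2)) ^ 2 := by
  have h0 := (norm_pos_iff.2 (one_sub_ne_zero_of_mem_ball hζ)).ne'
  rw [det_restrictScalars_toSpanSingleton, abs_of_nonneg (by positivity), cayley_re, norm_div,
    norm_pow, div_pow, div_pow]
  simp only [Complex.norm_ofNat]
  field_simp
  ring

/-! ### The reproducing kernel -/

theorem add_conj_ne_zero {z w : ℂ} (hz : z ∈ rightHalfPlane) (hw : w ∈ rightHalfPlane) :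
    z + conj w ≠ 0 := by
  intro h
  have hz' : 0 < z.re := hz
  have hw' : 0 < w.re := hw
  have := congrArg Complex.re h
  simp at this
  linarith

theorem one_mem_rightHalfPlane : (1 : ℂ) ∈ rightHalfPlane := by simp [rightHalfPlane]

namespace Bergman

variable {ℓ : ℕ}

theorem mk_apply (h : ℂ → ℂ) (hh : h ∈ bergmanSubmodule ℓ) (z : ℂ) : (mk h hh : Bergman ℓ) z = h z :=
  rfl

theorem indicator_one_div_mem (ℓ : ℕ) :
    (rightHalfPlane.indicator fun z => 1 / (z + 1) ^ (ℓ + 2)) ∈ bergmanSubmodule ℓ := by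
  refine ⟨?_, fun z hz => indicator_of_notMem hz _, ?_⟩
  · refine DifferentiableOn.congr (f := fun z => 1 / (z + 1) ^ (ℓ + 2)) ?_
      fun z hz => indicator_of_mem hz _
    refine (differentiableOn_const _).div (by fun_prop) fun z hz => pow_ne_zero _ ?_
    simpa using add_conj_ne_zero hz one_mem_rightHalfPlane
  · rw [← image_cayley, integrableOn_image_iff_integrableOn_abs_det_fderiv_smul volume
      measurableSet_ball (fun ζ hζ => (hasDerivAt_cayley hζ).hasFDerivWithinAt_real) injOn_cayley]
    -- On the disc the Jacobian factor cancels against |z + 1|^(-2(ℓ+2)), and this continuous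
    -- function remains.
    have hc : Continuous fun ζ : ℂ => 4 * (1 - ‖ζ‖ ^ 2) ^ ℓ * (((2 : ℝ) ^ (ℓ + 2)) ^ 2)⁻¹ := by
      fun_prop
    have hi : IntegrableOn (fun ζ : ℂ => 4 * (1 - ‖ζ‖ ^ 2) ^ ℓ * (((2 : ℝ) ^ (ℓ + 2)) ^ 2)⁻¹)
        (Metric.ball 0 1) :=
      (hc.continuousOn.integrableOn_compact (isCompact_closedBall 0 1)).mono_set
        Metric.ball_subset_closedBall
    refine hi.congr_fun (fun ζ hζ => ?_) measurableSet_ball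
    have h0 := (norm_pos_iff.2 (one_sub_ne_zero_of_mem_ball hζ)).ne'
    simp only
    rw [smul_eq_mul, ← mul_assoc, abs_det_cayley_mul_re_pow ℓ hζ,
      image_cayley, indicator_of_mem (cayley_mem hζ), cayley_add_one hζ]
    simp only [norm_div, norm_pow, norm_one, Complex.norm_ofNat, div_pow]
    field_simp

/-- The function `(z + 1) ^ (-(ℓ + 2))` on the half-plane. -/
noncomputable def kerOne (ℓ : ℕ) : Bergman ℓ := mk _ (indicator_one_div_mem ℓ)

theorem kerOne_apply {z : ℂ} (hz : z ∈ rightHalfPlane) : kerOne ℓ z = 1 / (z + 1) ^ (ℓ + 2) := by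
  rw [kerOne, mk_apply, indicator_of_mem hz]

/-- Pulled back to the disc, the integrand is (1 - |ζ|²)^ℓ times a holomorphic function, so the
weighted mean value property evaluates it at ζ = 0, that is, at z = 1. -/
theorem inner_kerOne (h : Bergman ℓ) :
    inner ℂ (kerOne ℓ) h = (2 ^ ℓ * ((ℓ : ℂ) + 1))⁻¹ * h 1 := by
  have hsm : ∀ ζ ∈ Metric.ball (0 : ℂ) 1,
      |((ContinuousLinearMap.toSpanSingleton ℂ (2 / (1 - ζ) ^ 2)).restrictScalars ℝ
        : ℂ →L[ℝ] ℂ).det| •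
          (((cayley ζ).re : ℂ) ^ ℓ * (conj (kerOne ℓ (cayley ζ)) * h (cayley ζ))) =
        ((1 - ‖ζ‖ ^ 2 : ℝ) : ℂ) ^ ℓ *
          ((2 ^ ℓ : ℂ)⁻¹ * h (cayley ζ) / (1 - ζ) ^ (ℓ + 2)) := by
    intro ζ hζ
    have h0 := one_sub_ne_zero_of_mem_ball hζ
    have h0' : 1 - conj ζ ≠ 0 := by
      have := (map_ne_zero (starRingEnd ℂ)).2 h0
      simpa using this
    rw [Complex.real_smul, ← mul_assoc, ← Complex.ofReal_pow, ← Complex.ofReal_mul,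
      abs_det_cayley_mul_re_pow ℓ hζ, kerOne_apply (cayley_mem hζ), cayley_add_one hζ]
    have hn : (((‖1 - ζ‖ ^ (ℓ + 2)) ^ 2 : ℝ) : ℂ) =
        (1 - ζ) ^ (ℓ + 2) * (1 - conj ζ) ^ (ℓ + 2) := by
      rw [← mul_pow, ← pow_mul, mul_comm (ℓ + 2) 2, pow_mul, Complex.ofReal_pow,
        ← Complex.normSq_eq_norm_sq, ← Complex.mul_conj]
      simp
    rw [Complex.ofReal_div, hn]
    simp only [map_div₀, map_pow, map_sub, map_one, map_ofNat, div_pow]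
    push_cast
    field_simp
    ring
  have hdiff : DifferentiableOn ℂ
      (fun ζ : ℂ => (2 ^ ℓ : ℂ)⁻¹ * h (cayley ζ) / (1 - ζ) ^ (ℓ + 2)) (Metric.ball 0 1) := by
    refine DifferentiableOn.div (DifferentiableOn.const_mul ?_ _) (by fun_prop)
      fun ζ hζ => pow_ne_zero _ (one_sub_ne_zero_of_mem_ball hζ)
    exact h.differentiableOn.comp
      (fun ζ hζ => (hasDerivAt_cayley hζ).differentiableAt.differentiableWithinAt)
      fun ζ hζ => cayley_mem hζ
  have hint := integrableOn_inner (kerOne ℓ) h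
  rw [← image_cayley, integrableOn_image_iff_integrableOn_abs_det_fderiv_smul volume
    measurableSet_ball (fun ζ hζ => (hasDerivAt_cayley hζ).hasFDerivWithinAt_real)
    injOn_cayley] at hint
  rw [inner_eq, ← image_cayley, integral_image_eq_integral_abs_det_fderiv_smul volume
    measurableSet_ball (fun ζ hζ => (hasDerivAt_cayley hζ).hasFDerivWithinAt_real) injOn_cayley,
    setIntegral_congr_fun measurableSet_ball hsm,
    integral_ball_weight_mul ℓ hdiff (hint.congr_fun hsm measurableSet_ball)]
  have h1 : (Real.pi : ℂ) ≠ 0 := by exact_mod_cast Real.pi_ne_zero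
  have h2 : (ℓ : ℂ) + 1 ≠ 0 := by exact_mod_cast Nat.succ_ne_zero ℓ
  simp only [cayley, add_zero, sub_zero, div_one, one_pow]
  field_simp

end Bergman

theorem norm_ofReal_sqrt_pow_sq {s : ℝ} (hs : 0 < s) (n : ℕ) :
    ‖((√s : ℝ) : ℂ) ^ n‖ ^ 2 = s ^ n := by
  rw [norm_pow, Complex.norm_real, Real.norm_of_nonneg (Real.sqrt_nonneg s), ← pow_mul, mul_comm,
    pow_mul, Real.sq_sqrt hs.le]

namespace Bergman

variable {ℓ : ℕ}

theorem affineIsometry_apply (a : ℂ) (s c : ℝ) (hs : 0 < s) (ha : ‖a‖ ^ 2 = s ^ (ℓ + 2))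
    (h : Bergman ℓ) (z : ℂ) :
    affineIsometry a s c hs ha h z = a * h ((s : ℂ) * z + Complex.I * c) := rfl

/-- The reproducing kernel `2 ^ ℓ (ℓ + 1) (z + conj w) ^ (-(ℓ + 2))`. -/
noncomputable def ker (ℓ : ℕ) (w : ℂ) (hw : w ∈ rightHalfPlane) : Bergman ℓ :=
  ((2 : ℂ) ^ ℓ * ((ℓ : ℂ) + 1) * ((√w.re⁻¹ : ℝ) : ℂ) ^ (ℓ + 2)) •
    affineIsometry (((√w.re⁻¹ : ℝ) : ℂ) ^ (ℓ + 2)) w.re⁻¹ (-w.re⁻¹ * w.im)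
      (inv_pos.2 hw) (norm_ofReal_sqrt_pow_sq (inv_pos.2 hw) _) (kerOne ℓ)

/-- The kernel is defined as an affine isometric image of `kerOne`, so that membership in the space
is automatic; the closed formula is recovered here. The two factors (√(1 / Re w))^(ℓ+2) come from
the normalization and from the isometry. -/
theorem ker_apply {w z : ℂ} (hw : w ∈ rightHalfPlane) (hz : z ∈ rightHalfPlane) :
    ker ℓ w hw z = 2 ^ ℓ * ((ℓ : ℂ) + 1) / (z + conj w) ^ (ℓ + 2) := by
  have hw' : 0 < w.re := hw
  have hw0 : (w.re : ℂ) ≠ 0 := by exact_mod_cast hw'.ne'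
  have hz0 := add_conj_ne_zero hz hw
  have hsq : ((√w.re⁻¹ : ℝ) : ℂ) ^ (ℓ + 2) * ((√w.re⁻¹ : ℝ) : ℂ) ^ (ℓ + 2) =
      1 / (w.re : ℂ) ^ (ℓ + 2) := by
    rw [← mul_pow, ← Complex.ofReal_mul, Real.mul_self_sqrt (inv_nonneg.2 hw'.le),
      Complex.ofReal_inv, inv_pow, one_div]
  have hmem : ((w.re⁻¹ : ℝ) : ℂ) * z + Complex.I * ((-w.re⁻¹ * w.im : ℝ) : ℂ) ∈ rightHalfPlane := by
    rw [← image_affine_rightHalfPlane (inv_pos.2 hw') (-w.re⁻¹ * w.im)]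
    exact mem_image_of_mem _ hz
  have harg : ((w.re⁻¹ : ℝ) : ℂ) * z + Complex.I * ((-w.re⁻¹ * w.im : ℝ) : ℂ) + 1 =
      (z + conj w) / w.re := by
    have hcw : conj w = w.re - w.im * Complex.I := by
      apply Complex.ext <;> simp
    rw [hcw]
    push_cast
    field_simp
    ring
  rw [ker, coe_smul, Pi.smul_apply, affineIsometry_apply, kerOne_apply hmem, harg, smul_eq_mul,
    div_pow]
  calc _ = 2 ^ ℓ * ((ℓ : ℂ) + 1) *
      (((√w.re⁻¹ : ℝ) : ℂ) ^ (ℓ + 2) * ((√w.re⁻¹ : ℝ) : ℂ) ^ (ℓ + 2)) *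
        (1 / ((z + conj w) ^ (ℓ + 2) / (w.re : ℂ) ^ (ℓ + 2))) := by ring
    _ = _ := by rw [hsq]; field_simp

/-- The reproducing property. -/
theorem inner_ker {w : ℂ} (hw : w ∈ rightHalfPlane) (h : Bergman ℓ) :
    inner ℂ (ker ℓ w hw) h = h w := by
  have hw' : 0 < w.re := hw
  have hw0 : (w.re : ℂ) ≠ 0 := by exact_mod_cast hw'.ne'
  have hc1 : (2 : ℂ) ^ ℓ * ((ℓ : ℂ) + 1) ≠ 0 :=
    mul_ne_zero (pow_ne_zero _ two_ne_zero) (by exact_mod_cast Nat.succ_ne_zero ℓ)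
  -- This isometry substitutes z ↦ (Re w) z + i Im w, which sends 1 to w; it reduces the claim to
  -- the kernel at 1.
  set V : Bergman ℓ →ₗᵢ[ℂ] Bergman ℓ := affineIsometry (((√w.re : ℝ) : ℂ) ^ (ℓ + 2)) w.re w.im hw'
    (norm_ofReal_sqrt_pow_sq hw' _) with hV
  have hss : ((√w.re : ℝ) : ℂ) ^ (ℓ + 2) * ((√w.re : ℝ) : ℂ) ^ (ℓ + 2) =
      (w.re : ℂ) ^ (ℓ + 2) := by
    rw [← mul_pow, ← Complex.ofReal_mul, Real.mul_self_sqrt hw'.le]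
  have hs0 : ((√w.re : ℝ) : ℂ) ^ (ℓ + 2) ≠ 0 :=
    pow_ne_zero _ (by exact_mod_cast (Real.sqrt_pos.2 hw').ne')
  have h1 : V (ker ℓ w hw) =
      (2 ^ ℓ * ((ℓ : ℂ) + 1) / ((√w.re : ℝ) : ℂ) ^ (ℓ + 2)) • kerOne ℓ := by
    refine ext_fun fun z hz => ?_
    have hmem : (w.re : ℂ) * z + Complex.I * w.im ∈ rightHalfPlane := by
      rw [← image_affine_rightHalfPlane hw' w.im]
      exact mem_image_of_mem _ hz
    have hz1 : z + 1 ≠ 0 := by simpa using add_conj_ne_zero hz one_mem_rightHalfPlane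
    have harg : (w.re : ℂ) * z + Complex.I * w.im + conj w = w.re * (z + 1) := by
      have hcw : conj w = w.re - w.im * Complex.I := by
        apply Complex.ext <;> simp
      rw [hcw]
      ring
    rw [hV, affineIsometry_apply, ker_apply hw hmem, harg, coe_smul, Pi.smul_apply, kerOne_apply hz,
      smul_eq_mul, mul_pow, ← hss]
    field_simp
  rw [← V.inner_map_map, h1, inner_smul_left, inner_kerOne, hV, affineIsometry_apply]
  have h2 : (w.re : ℂ) * 1 + Complex.I * w.im = w := by
    apply Complex.ext <;> simp
  rw [h2]
  simp only [map_div₀, map_mul, map_pow, map_ofNat, map_add, map_natCast, map_one,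
    Complex.conj_ofReal]
  field_simp

theorem norm_apply_le {w : ℂ} (hw : w ∈ rightHalfPlane) (h : Bergman ℓ) :
    ‖h w‖ ≤ ‖ker ℓ w hw‖ * ‖h‖ := by
  rw [← inner_ker hw h]
  exact norm_inner_le_norm _ _

theorem norm_ker_sq {w : ℂ} (hw : w ∈ rightHalfPlane) :
    ‖ker ℓ w hw‖ ^ 2 = 2 ^ ℓ * ((ℓ : ℝ) + 1) / (2 * w.re) ^ (ℓ + 2) := by
  have h1 := inner_ker hw (ker ℓ w hw)
  rw [inner_self_eq_norm_sq_to_K, ker_apply hw hw, Complex.add_conj] at h1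
  have h2 : ((‖ker ℓ w hw‖ ^ 2 : ℝ) : ℂ) =
      ((2 ^ ℓ * ((ℓ : ℝ) + 1) / (2 * w.re) ^ (ℓ + 2) : ℝ) : ℂ) := by
    push_cast
    simpa using h1
  exact_mod_cast h2

/-! ### Completeness of the Bergman space -/

/-- The scaled function `x ^ (ℓ / 2) h`, whose `L²` norm is the norm of `h` up to a factor. -/
noncomputable def weighted (ℓ : ℕ) (h : ℂ → ℂ) (z : ℂ) : ℂ := ((√(z.re ^ ℓ) : ℝ) : ℂ) * h z

theorem norm_weighted_sq (h : ℂ → ℂ) {z : ℂ} (hz : z ∈ rightHalfPlane) :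
    ‖weighted ℓ h z‖ ^ 2 = z.re ^ ℓ * ‖h z‖ ^ 2 := by
  have hz' : 0 < z.re := hz
  rw [weighted, norm_mul, mul_pow, Complex.norm_real, Real.norm_of_nonneg (Real.sqrt_nonneg _),
    Real.sq_sqrt (by positivity)]

theorem aestronglyMeasurable_weighted {h : ℂ → ℂ} (hh : DifferentiableOn ℂ h rightHalfPlane) :
    AEStronglyMeasurable (weighted ℓ h) (volume.restrict rightHalfPlane) := by
  refine ContinuousOn.aestronglyMeasurable ?_ isOpen_rightHalfPlane.measurableSet
  refine ContinuousOn.mul (Continuous.continuousOn ?_) hh.continuousOn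
  fun_prop

theorem memLp_weighted_iff {h : ℂ → ℂ} (hh : DifferentiableOn ℂ h rightHalfPlane) :
    MemLp (weighted ℓ h) 2 (volume.restrict rightHalfPlane) ↔
      IntegrableOn (fun z : ℂ => z.re ^ ℓ * ‖h z‖ ^ 2) rightHalfPlane := by
  rw [memLp_two_iff_integrable_sq_norm (aestronglyMeasurable_weighted hh)]
  exact integrableOn_congr_fun (fun z hz => norm_weighted_sq h hz)
    isOpen_rightHalfPlane.measurableSet

theorem eLpNorm_weighted (h : Bergman ℓ) :
    eLpNorm (weighted ℓ h) 2 (volume.restrict rightHalfPlane) =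
      ENNReal.ofReal (√Real.pi * ‖h‖) := by
  have hm := (memLp_weighted_iff h.differentiableOn).2 h.integrableOn
  rw [hm.eLpNorm_eq_integral_rpow_norm two_ne_zero ENNReal.ofNat_ne_top]
  congr 1
  have h1 : ∫ z in rightHalfPlane, ‖weighted ℓ h z‖ ^ (2 : ENNReal).toReal =
      Real.pi * ‖h‖ ^ 2 := by
    rw [norm_sq_eq, mul_inv_cancel_left₀ Real.pi_ne_zero]
    refine setIntegral_congr_fun isOpen_rightHalfPlane.measurableSet fun z hz => ?_
    simp only [ENNReal.toReal_ofNat, Real.rpow_ofNat]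
    exact norm_weighted_sq h hz
  rw [h1, ENNReal.toReal_ofNat, ← one_div, ← Real.sqrt_eq_rpow, Real.sqrt_mul Real.pi_pos.le,
    Real.sqrt_sq (norm_nonneg h)]

theorem coe_sub (h k : Bergman ℓ) : ((h - k : Bergman ℓ) : ℂ → ℂ) = h - k := rfl

theorem weighted_sub (h k : ℂ → ℂ) : weighted ℓ (h - k) = weighted ℓ h - weighted ℓ k :=
  funext fun _ => mul_sub _ _ _

/-- The norm of K_z is bounded on Re z > (Re w)/2, so norm-Cauchy sequences are uniformly Cauchy
near w. This makes pointwise limits holomorphic. -/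
theorem tendstoLocallyUniformlyOn_of_cauchySeq {u : ℕ → Bergman ℓ} (hu : CauchySeq u) {k : ℂ → ℂ}
    (hk : ∀ z ∈ rightHalfPlane, Filter.Tendsto (fun n => u n z) Filter.atTop (nhds (k z))) :
    TendstoLocallyUniformlyOn (fun n => (u n : ℂ → ℂ)) k Filter.atTop rightHalfPlane := by
  rw [Metric.tendstoLocallyUniformlyOn_iff]
  intro ε hε w hw
  have hw' : 0 < w.re := hw
  set M : ℝ := 2 ^ ℓ * ((ℓ : ℝ) + 1) / w.re ^ (ℓ + 2) with hM
  have hM0 : 0 < M := by positivity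
  refine ⟨{z | w.re / 2 < z.re}, mem_nhdsWithin_of_mem_nhds
    ((isOpen_lt continuous_const Complex.continuous_re).mem_nhds (by simpa using hw')), ?_⟩
  have hb : ∀ z : ℂ, w.re / 2 < z.re → ∀ h : Bergman ℓ, ‖h z‖ ≤ √M * ‖h‖ := by
    intro z hz h
    have hz' : z ∈ rightHalfPlane := lt_trans (by positivity) hz
    refine (norm_apply_le hz' h).trans (mul_le_mul_of_nonneg_right ?_ (norm_nonneg h))
    refine Real.le_sqrt_of_sq_le ?_
    rw [norm_ker_sq, hM]
    have : w.re ≤ 2 * z.re := by linarith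
    gcongr
  obtain ⟨n₀, hn₀⟩ := Metric.cauchySeq_iff.1 hu (ε / (2 * √M)) (by positivity)
  filter_upwards [Filter.eventually_ge_atTop n₀] with n hn z hz
  have hz' : z ∈ rightHalfPlane := lt_trans (by positivity) hz
  have h1 : ∀ᶠ m in Filter.atTop, dist (u m z) (u n z) ≤ ε / 2 := by
    filter_upwards [Filter.eventually_ge_atTop n₀] with m hm
    have h2 := hb z hz (u m - u n)
    have h3 := hn₀ m hm n hn
    rw [dist_eq_norm] at h3 ⊢
    have h4 : (u m - u n) z = u m z - u n z := rfl
    rw [h4] at h2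
    refine h2.trans ?_
    calc √M * ‖u m - u n‖ ≤ √M * (ε / (2 * √M)) := by gcongr
      _ = ε / 2 := by field_simp
  have h5 := le_of_tendsto ((hk z hz').dist tendsto_const_nhds) h1
  linarith

/-- The pointwise limit, which exists by the reproducing property, is holomorphic and is also the L²
limit of the weighted functions. Completeness is needed for Hilbert space adjoints. -/
instance : CompleteSpace (Bergman ℓ) := by
  -- The geometric bound is summable, as the L² criterion requires; the division by √π compensates
  -- for the factor 1/π in the norm.
  refine Metric.complete_of_convergent_controlled_sequences (fun n => (1 / 2 : ℝ) ^ n / √Real.pi)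
    (fun n => by have := Real.pi_pos; positivity) fun u hu => ?_
  have hpi : 0 < √Real.pi := Real.sqrt_pos.2 Real.pi_pos
  have hB : Filter.Tendsto (fun n => (1 / 2 : ℝ) ^ n / √Real.pi) Filter.atTop (nhds 0) := by
    simpa using (tendsto_pow_atTop_nhds_zero_of_lt_one (r := (1 / 2 : ℝ)) (by norm_num)
      (by norm_num)).div_const (√Real.pi)
  have hcau : CauchySeq u := cauchySeq_of_le_tendsto_0 _
    (fun n m N hn hm => (hu N n m hn hm).le) hB
  have hpt : ∀ z : ℂ, ∃ a : ℂ, Filter.Tendsto (fun n => u n z) Filter.atTop (nhds a) := by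
    intro z
    by_cases hz : z ∈ rightHalfPlane
    · have := ((innerSL ℂ (ker ℓ z hz)).uniformContinuous.comp_cauchySeq hcau)
      obtain ⟨a, ha⟩ := cauchySeq_tendsto_of_complete this
      refine ⟨a, ha.congr fun n => ?_⟩
      exact inner_ker hz (u n)
    · exact ⟨0, tendsto_const_nhds.congr fun n => ((u n).eq_zero_of_notMem hz).symm⟩
  choose k hk using hpt
  have hdiff : DifferentiableOn ℂ k rightHalfPlane :=
    (tendstoLocallyUniformlyOn_of_cauchySeq hcau fun z _ => hk z).differentiableOn
      (Filter.Eventually.of_forall fun n => (u n).differentiableOn) isOpen_rightHalfPlane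
  have hk0 : ∀ z, z ∉ rightHalfPlane → k z = 0 := fun z hz =>
    tendsto_nhds_unique (hk z) (tendsto_const_nhds.congr fun n => ((u n).eq_zero_of_notMem hz).symm)
  have hsum : ∑' n : ℕ, ENNReal.ofReal ((1 / 2 : ℝ) ^ n) ≠ ⊤ :=
    (summable_geometric_two).tsum_ofReal_ne_top
  have hlim : Filter.Tendsto (fun n => eLpNorm (weighted ℓ (u n) - weighted ℓ k) 2
      (volume.restrict rightHalfPlane)) Filter.atTop (nhds 0) := by
    refine Lp.cauchy_tendsto_of_tendsto
      (fun n => aestronglyMeasurable_weighted (u n).differentiableOn) _ hsum ?_ ?_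
    · intro N n m hn hm
      rw [← weighted_sub, ← coe_sub, eLpNorm_weighted,
        ENNReal.ofReal_lt_ofReal_iff (by positivity)]
      have := hu N n m hn hm
      rw [dist_eq_norm, lt_div_iff₀ hpi] at this
      linarith
    · exact Filter.Eventually.of_forall fun z => (hk z).const_mul _
  have hmem : MemLp (weighted ℓ k) 2 (volume.restrict rightHalfPlane) :=
    Lp.memLp_of_cauchy_tendsto (by norm_num)
      (fun n => (memLp_weighted_iff (u n).differentiableOn).2 (u n).integrableOn) _
      (aestronglyMeasurable_weighted hdiff) hlim
  refine ⟨mk k ⟨hdiff, hk0, (memLp_weighted_iff hdiff).1 hmem⟩, ?_⟩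
  rw [tendsto_iff_norm_sub_tendsto_zero]
  set K : Bergman ℓ := mk k ⟨hdiff, hk0, (memLp_weighted_iff hdiff).1 hmem⟩ with hK
  have h1 : ∀ n, eLpNorm (weighted ℓ (u n) - weighted ℓ k) 2 (volume.restrict rightHalfPlane) =
      ENNReal.ofReal (√Real.pi * ‖u n - K‖) := fun n => by
    rw [← eLpNorm_weighted, coe_sub, weighted_sub]
    rfl
  simp only [h1] at hlim
  have h2 := (ENNReal.tendsto_toReal ENNReal.zero_ne_top).comp hlim
  have h3 := h2.const_mul (√Real.pi)⁻¹
  simp only [ENNReal.toReal_zero, mul_zero] at h3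
  refine h3.congr fun n => ?_
  rw [Function.comp, ENNReal.toReal_ofReal (by positivity), inv_mul_cancel_left₀ hpi.ne']

end Bergman

/-- Since 1/z lies in the half-plane, so does w + 1/z. -/
theorem one_add_mul_ne_zero {z w : ℂ} (hz : z ∈ rightHalfPlane) (hw : w ∈ rightHalfPlane) :
    1 + z * w ≠ 0 := by
  have hz0 := ne_zero_of_mem_rightHalfPlane hz
  have h1 := add_conj_ne_zero hw ((star_mem_rightHalfPlane_iff z).2 hz)
  intro h
  refine h1 ?_
  simp only [one_div, map_inv₀, Complex.conj_conj]
  field_simp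
  linear_combination h

/-! ### Antilinear isometries and adjoints of bounded operators -/

section Operators

variable {E : Type*} [NormedAddCommGroup E] [InnerProductSpace ℂ E]

/-- Polarization: J preserves norms and exchanges the two terms that carry i and -i. -/
theorem inner_conj_map_map (J : E ≃ₗᵢ⋆[ℂ] E) (x y : E) : inner ℂ (J x) (J y) = inner ℂ y x := by
  have h1 : J x - Complex.I • J y = J (x + Complex.I • y) := by
    rw [map_add, LinearIsometryEquiv.map_smulₛₗ, Complex.conj_I, neg_smul, sub_eq_add_neg]
  have h2 : J x + Complex.I • J y = J (x - Complex.I • y) := by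
    rw [map_sub, LinearIsometryEquiv.map_smulₛₗ, Complex.conj_I, neg_smul, sub_neg_eq_add]
  rw [← inner_conj_symm y x, inner_eq_sum_norm_sq_div_four x y, inner_eq_sum_norm_sq_div_four]
  simp only [RCLike.I_to_complex]
  rw [h1, h2, ← map_add, ← map_sub]
  simp only [LinearIsometryEquiv.norm_map]
  simp [map_ofNat]
  ring

theorem IsBoundedPMap.exists_mem_adjoint [CompleteSpace E] {T : E →ₗ.[ℂ] E}
    (hT : IsBoundedPMap T) (y : E) : ∃ w, (y, w) ∈ T.graph.adjoint := by
  obtain ⟨hd, L, -, hL⟩ := hT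
  have hmem : ∀ x : E, x ∈ T.domain := fun x => hd ▸ Submodule.mem_top
  let S : E →L[ℂ] E := LinearMap.mkContinuous
    { toFun := fun x => T ⟨x, hmem x⟩
      map_add' := fun x y => by rw [← LinearPMap.map_add]; rfl
      map_smul' := fun r x => by rw [RingHom.id_apply, ← LinearPMap.map_smul]; rfl } L
    fun x => hL ⟨x, hmem x⟩
  refine ⟨S.adjoint y, ?_⟩
  rw [Submodule.mem_adjoint_iff]
  intro a b hab
  obtain ⟨x, rfl, rfl⟩ := (LinearPMap.mem_graph_iff T).1 hab
  rw [ContinuousLinearMap.adjoint_inner_right]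
  exact sub_self _

end Operators

/-! ### Kernel identity and selfadjointness -/

theorem conj_kernel_apply {ℓ : ℕ} {w z : ℂ} (hw : w ∈ rightHalfPlane) (hz : z ∈ rightHalfPlane) :
    bergmanC ℓ (Bergman.ker ℓ w hw) z = 2 ^ ℓ * ((ℓ : ℂ) + 1) / (1 + z * w) ^ (ℓ + 2) := by
  have hz0 := ne_zero_of_mem_rightHalfPlane hz
  rw [bergmanC_apply, Bergman.ker_apply hw ((star_mem_rightHalfPlane_iff z).2 hz)]
  simp only [map_div₀, map_mul, map_pow, map_ofNat, map_add, map_natCast, map_one,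
    Complex.conj_conj]
  rw [div_mul_div_comm, one_mul, ← mul_pow, mul_add z, mul_one_div_cancel hz0]

theorem inner_conj_kernel {ℓ : ℕ} {w : ℂ} (hw : w ∈ rightHalfPlane) (h : Bergman ℓ) :
    inner ℂ (bergmanC ℓ (Bergman.ker ℓ w hw)) h = conj (bergmanC ℓ h w) := by
  rw [← Bergman.inner_ker hw (bergmanC ℓ h), inner_conj_symm]
  conv_rhs => rw [← inner_conj_map_map (bergmanC ℓ)]
  congr 1
  exact (Bergman.starFun_starFun h).symm

/-- Maximality of the domain removes any separate domain condition: k itself witnesses that f · (h ∘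
g) lies in the space. -/
theorem mem_graph_wcoMax_iff {ℓ : ℕ} {f g : ℂ → ℂ} {h k : Bergman ℓ} :
    (h, k) ∈ (wcoMax ℓ f g).graph ↔ ∀ z ∈ rightHalfPlane, k z = f z * h (g z) := by
  rw [LinearPMap.mem_graph_iff]
  constructor
  · rintro ⟨x, rfl, rfl⟩ z hz
    rw [wcoMax_apply, wcoExpr, indicator_of_mem hz]
  · intro H
    have hk : (k : ℂ → ℂ) = wcoExpr f g h := by
      funext z
      by_cases hz : z ∈ rightHalfPlane
      · rw [wcoExpr, indicator_of_mem hz, H z hz]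
      · rw [wcoExpr, indicator_of_notMem hz, k.eq_zero_of_notMem hz]
    refine ⟨⟨h, ?_⟩, rfl, ?_⟩
    · rw [mem_wcoMax_domain, ← hk]
      exact k.coe_mem
    · exact DFunLike.ext' ((wcoMax_apply ℓ f g _).trans hk.symm)

section Symmetry

variable {ℓ : ℕ} {f g : ℂ → ℂ}

/-- Both pairings evaluate to the conjugate of f(w) h(g(w)). The adjoint is a relation here, so no
density is required. -/
theorem kernel_mem_adjoint (hg : MapsTo g rightHalfPlane rightHalfPlane) {w : ℂ}
    (hw : w ∈ rightHalfPlane) :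
    (Bergman.ker ℓ w hw, conj (f w) • Bergman.ker ℓ (g w) (hg hw)) ∈
      (wcoMax ℓ f g).graph.adjoint := by
  rw [Submodule.mem_adjoint_iff]
  intro h k hk
  rw [inner_smul_right, ← inner_conj_symm, Bergman.inner_ker, ← inner_conj_symm h,
    Bergman.inner_ker, mem_graph_wcoMax_iff.1 hk w hw, map_mul, sub_self]

/-- Selfadjointness carries the action of T* on K_w to T C⋆ K_w = f(w) C⋆ K_{g w}; evaluating at z
and clearing denominators gives the identity. -/
theorem IsConjSelfAdjoint.kernel_symm (hg : MapsTo g rightHalfPlane rightHalfPlane)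
    (H : IsConjSelfAdjoint (bergmanC ℓ) (wcoMax ℓ f g)) {z w : ℂ} (hz : z ∈ rightHalfPlane)
    (hw : w ∈ rightHalfPlane) :
    f z * (1 + z * g w) ^ (ℓ + 2) = f w * (1 + w * g z) ^ (ℓ + 2) := by
  have hCC : bergmanC ℓ (bergmanC ℓ (Bergman.ker ℓ w hw)) = Bergman.ker ℓ w hw :=
    Bergman.starFun_starFun _
  have h1 := (H.2 (bergmanC ℓ (Bergman.ker ℓ w hw)) _).2
    ⟨_, by rw [hCC]; exact kernel_mem_adjoint hg hw, rfl⟩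
  have h2 := mem_graph_wcoMax_iff.1 h1 z hz
  rw [LinearIsometryEquiv.map_smulₛₗ, Complex.conj_conj, Bergman.coe_smul, Pi.smul_apply,
    conj_kernel_apply (hg hw) hz, conj_kernel_apply hw (hg hz), smul_eq_mul] at h2
  have hc1 : (2 : ℂ) ^ ℓ * ((ℓ : ℂ) + 1) ≠ 0 :=
    mul_ne_zero (pow_ne_zero _ two_ne_zero) (by exact_mod_cast Nat.succ_ne_zero ℓ)
  have e1 := pow_ne_zero (ℓ + 2) (one_add_mul_ne_zero hz (hg hw))
  have e2 := pow_ne_zero (ℓ + 2) (one_add_mul_ne_zero (hg hz) hw)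
  rw [mul_div_assoc', mul_div_assoc', div_eq_div_iff e1 e2] at h2
  refine mul_left_cancel₀ hc1 ?_
  rw [mul_comm w]
  linear_combination -h2

theorem isConjSelfAdjoint_of_bounded (hg : MapsTo g rightHalfPlane rightHalfPlane)
    (hb : IsBoundedPMap (wcoMax ℓ f g))
    (hs : ∀ z ∈ rightHalfPlane, ∀ w ∈ rightHalfPlane,
      f z * (1 + z * g w) ^ (ℓ + 2) = f w * (1 + w * g z) ^ (ℓ + 2)) :
    IsConjSelfAdjoint (bergmanC ℓ) (wcoMax ℓ f g) := by
  have hd : Dense ((wcoMax ℓ f g).domain : Set (Bergman ℓ)) := by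
    rw [hb.1]
    exact dense_univ
  -- The inclusion of C⋆ T* C⋆ in T uses only the kernel identity: it gives T C⋆ K_z = f(z) C⋆ K_{g
  -- z}, and pairing an element of the adjoint with this pair reads off the value at z.
  have key : ∀ u w : Bergman ℓ, (bergmanC ℓ u, w) ∈ (wcoMax ℓ f g).graph.adjoint →
      (u, bergmanC ℓ w) ∈ (wcoMax ℓ f g).graph := by
    intro u w huw
    rw [mem_graph_wcoMax_iff]
    intro z hz
    have hmem : (bergmanC ℓ (Bergman.ker ℓ z hz),
        f z • bergmanC ℓ (Bergman.ker ℓ (g z) (hg hz))) ∈ (wcoMax ℓ f g).graph := by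
      rw [mem_graph_wcoMax_iff]
      intro v hv
      rw [Bergman.coe_smul, Pi.smul_apply, conj_kernel_apply (hg hz) hv,
        conj_kernel_apply hz (hg hv), smul_eq_mul, mul_div_assoc', mul_div_assoc',
        div_eq_div_iff (pow_ne_zero _ (one_add_mul_ne_zero hv (hg hz)))
          (pow_ne_zero _ (one_add_mul_ne_zero (hg hv) hz)), mul_comm (g v)]
      linear_combination -(2 ^ ℓ * ((ℓ : ℂ) + 1)) * hs v hv z hz
    have h1 := (Submodule.mem_adjoint_iff _ _).1 huw _ _ hmem
    have hCC : bergmanC ℓ (bergmanC ℓ u) = u := Bergman.starFun_starFun _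
    rw [inner_smul_left, inner_conj_kernel, inner_conj_kernel, hCC, ← map_mul, ← map_sub,
      map_eq_zero, sub_eq_zero] at h1
    exact h1.symm
  refine ⟨hd, fun u v => ⟨fun huv => ?_, ?_⟩⟩
  -- The reverse inclusion is where boundedness enters: T* is defined at every vector, and T is
  -- single-valued.
  · obtain ⟨w, hw⟩ := hb.exists_mem_adjoint (bergmanC ℓ u)
    have h1 := key u w hw
    refine ⟨w, hw, ?_⟩
    exact LinearPMap.mem_graph_snd_inj _ huv h1 rfl
  · rintro ⟨w, hw, rfl⟩
    exact key u w hw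

end Symmetry

/-! ### Linear fractional self-maps of the half-plane -/

/-- The condition on the parameters under which `z ↦ (1 - δ κ) / (z + κ) + δ` maps the half-plane
into itself. -/
def MoebiusCond (δ κ : ℂ) : Prop :=
  (δ.re = 0 ∧ (δ * κ).im = 0 ∧ (δ * κ).re < 1 ∧ 0 ≤ κ.re) ∨
    (-δ.re < 0 ∧ 0 ≤ κ.re - ((δ * κ - 1).re + ‖δ * κ - 1‖) / (2 * δ.re))

/-- The symbols of the weighted composition operators selfadjoint with respect to `bergmanC`. -/
def StarSymbol (ℓ : ℕ) (f g : ℂ → ℂ) : Prop :=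
  (∀ w ∈ rightHalfPlane, f w = 0) ∨
  (∃ α β : ℂ, α ∈ rightHalfPlane ∧
    ∀ w ∈ rightHalfPlane, g w = α ∧ f w = β / (1 + α * w) ^ (ℓ + 2)) ∨
  (∃ (lam : ℝ) (θ : ℂ), 0 < lam ∧ ∀ w ∈ rightHalfPlane, g w = lam * w ∧ f w = θ) ∨
  (∃ δ κ r : ℂ, MoebiusCond δ κ ∧
    ∀ w ∈ rightHalfPlane, g w = (1 - δ * κ) / (w + κ) + δ ∧ f w = r / (w + κ) ^ (ℓ + 2))

theorem re_add_div_mul_normSq (δ D : ℂ) {u : ℂ} (hu : u ≠ 0) :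
    (D / u + δ).re * Complex.normSq u =
      δ.re * (u.re ^ 2 + u.im ^ 2) + D.re * u.re + D.im * u.im := by
  have h1 : Complex.normSq u ≠ 0 := (Complex.normSq_pos.2 hu).ne'
  have h2 : Complex.normSq u = u.re ^ 2 + u.im ^ 2 := by
    rw [Complex.normSq_apply]
    ring
  rw [Complex.add_re, Complex.div_re, add_mul, add_mul, div_mul_cancel₀ _ h1,
    div_mul_cancel₀ _ h1, h2]
  ring

theorem ne_zero_of_re_pos {u : ℂ} (hu : 0 < u.re) : u ≠ 0 := ne_zero_of_mem_rightHalfPlane hu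

theorem MoebiusCond.re_nonneg {δ κ : ℂ} (h : MoebiusCond δ κ) : 0 ≤ κ.re := by
  rcases h with ⟨-, -, -, h⟩ | ⟨h1, h2⟩
  · exact h
  · have h3 : 0 ≤ ((δ * κ - 1).re + ‖δ * κ - 1‖) / (2 * δ.re) := by
      have := neg_le_of_abs_le (Complex.abs_re_le_norm (δ * κ - 1))
      exact div_nonneg (by linarith) (by linarith)
    linarith

/-- With u = w + κ, positivity of the real part is positivity of a real quadratic on Re u > Re κ,
and the sign of its leading coefficient Re δ separates the cases. -/
theorem moebiusCond_of_mapsTo {δ κ : ℂ} (hκ : 0 ≤ κ.re)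
    (H : ∀ u : ℂ, κ.re < u.re → 0 < ((1 - δ * κ) / u + δ).re) : MoebiusCond δ κ := by
  set D : ℂ := 1 - δ * κ with hD
  have H' : ∀ x y : ℝ, κ.re < x → 0 < δ.re * (x ^ 2 + y ^ 2) + D.re * x + D.im * y := by
    intro x y hx
    have hu : (⟨x, y⟩ : ℂ) ≠ 0 := ne_zero_of_re_pos (hκ.trans_lt hx)
    have h1 := re_add_div_mul_normSq δ D hu
    simp only at h1
    rw [← h1]
    exact mul_pos (H _ hx) (Complex.normSq_pos.2 hu)
  rcases lt_trichotomy δ.re 0 with hd | hd | hd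
  · exfalso
    -- Large enough for the quadratic to be nonpositive at the real point X.
    set X : ℝ := κ.re + 1 + |D.re| / (-δ.re) with hX
    have h0 : 0 ≤ |D.re| / (-δ.re) := div_nonneg (abs_nonneg _) (by linarith)
    have h1 := H' X 0 (by linarith)
    have h2 : δ.re * X + D.re ≤ 0 := by
      have h3 : δ.re * X = δ.re * (κ.re + 1) - |D.re| := by
        have := hd.ne
        rw [hX]
        field_simp
        ring
      nlinarith [le_abs_self D.re]
    nlinarith
  · left
    have him : D.im = 0 := by
      by_contra hne
      -- For Re δ = 0 the form is linear, and this ordinate makes it vanish.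
      have h1 := H' (κ.re + 1) (-(D.re * (κ.re + 1)) / D.im) (by linarith)
      rw [hd, mul_div_cancel₀ _ hne] at h1
      linarith
    have hre := H' (κ.re + 1) 0 (by linarith)
    rw [hd] at hre
    have hre' : 0 < D.re := by nlinarith
    have e1 : D.im = -(δ * κ).im := by simp [hD]
    have e2 : D.re = 1 - (δ * κ).re := by simp [hD]
    exact ⟨hd, by linarith, by linarith, hκ⟩
  · right
    refine ⟨by linarith, ?_⟩
    by_contra hlt
    set E : ℂ := δ * κ - 1 with hE
    have hDE : D = -E := by rw [hD, hE]; ring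
    -- The quadratic vanishes on the circle of centre E/(2 Re δ) and radius |E|/(2 Re δ); this is
    -- its rightmost point, which therefore cannot satisfy Re u > Re κ.
    have h1 := H' ((E.re + ‖E‖) / (2 * δ.re)) (E.im / (2 * δ.re)) (by linarith)
    have h2 : ‖E‖ ^ 2 = E.re ^ 2 + E.im ^ 2 := by
      rw [← Complex.normSq_eq_norm_sq, Complex.normSq_apply]
      ring
    have h3 : δ.re * (((E.re + ‖E‖) / (2 * δ.re)) ^ 2 + (E.im / (2 * δ.re)) ^ 2) +
        D.re * ((E.re + ‖E‖) / (2 * δ.re)) + D.im * (E.im / (2 * δ.re)) =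
        (‖E‖ ^ 2 - E.re ^ 2 - E.im ^ 2) / (4 * δ.re) := by
      rw [hDE, Complex.neg_re, Complex.neg_im]
      field_simp
      ring
    rw [h3, h2] at h1
    simp at h1

/-- The Schwarz–Pick inequality |g'(w)| Re w ≤ Re g(w), multiplied by |w + κ|². -/
theorem MoebiusCond.norm_mul_re_le {δ κ w : ℂ} (h : MoebiusCond δ κ) (hw : w ∈ rightHalfPlane) :
    ‖1 - δ * κ‖ * w.re ≤ ((1 - δ * κ) / (w + κ) + δ).re * Complex.normSq (w + κ) := by
  have hw' : 0 < w.re := hw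
  have hκ := h.re_nonneg
  have hu : w + κ ≠ 0 := ne_zero_of_re_pos (by rw [Complex.add_re]; linarith)
  rw [re_add_div_mul_normSq _ _ hu]
  rcases h with ⟨h1, h2, h3, -⟩ | ⟨h1, h2⟩
  · have e1 : (1 - δ * κ).im = 0 := by simp [h2]
    have e2 : 0 < (1 - δ * κ).re := by simpa using h3
    have e3 : ‖1 - δ * κ‖ = (1 - δ * κ).re := by
      rw [← Complex.abs_re_eq_norm.2 e1, abs_of_pos e2]
    rw [e3, e1, h1, Complex.add_re]
    nlinarith
  · have hd : 0 < δ.re := by linarith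
    set E : ℂ := δ * κ - 1 with hE
    have hDE : 1 - δ * κ = -E := by rw [hE]; ring
    rw [hDE, norm_neg, Complex.neg_re, Complex.neg_im, Complex.add_re, Complex.add_im]
    have h4 : ‖E‖ ^ 2 = E.re ^ 2 + E.im ^ 2 := by
      rw [← Complex.normSq_eq_norm_sq, Complex.normSq_apply]
      ring
    have h5 : E.re + ‖E‖ ≤ 2 * δ.re * κ.re := by
      have h6 : (E.re + ‖E‖) / (2 * δ.re) ≤ κ.re := by linarith
      rw [div_le_iff₀ (by positivity)] at h6
      linarith
    set Y : ℝ := 2 * δ.re * w.re with hY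
    have hY0 : 0 ≤ Y := by positivity
    have h7 : ‖E‖ + Y ≤ 2 * δ.re * (w.re + κ.re) - E.re := by
      rw [hY]
      linarith
    have h8 : (‖E‖ + Y) ^ 2 ≤ (2 * δ.re * (w.re + κ.re) - E.re) ^ 2 :=
      pow_le_pow_left₀ (by positivity) h7 2
    have h9 : 0 ≤ (2 * δ.re * (w.im + κ.im) - E.im) ^ 2 := sq_nonneg _
    -- After multiplication by 4 Re δ the right side is a sum of two squares minus |E|². The first
    -- square is at least (|E| + Y)², which leaves at least 2|E|Y.
    refine le_of_mul_le_mul_left (a := 4 * δ.re) ?_ (by positivity)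
    have h10 : 4 * δ.re * (‖E‖ * w.re) = 2 * ‖E‖ * Y := by rw [hY]; ring
    rw [h10]
    nlinarith [sq_nonneg Y]

/-! ### Solving the kernel identity -/

section Moebius

variable {ℓ : ℕ} {f g : ℂ → ℂ}

theorem exists_moebius_of_kernel_symm (hf : DifferentiableOn ℂ f rightHalfPlane)
    (hg : DifferentiableOn ℂ g rightHalfPlane) (hgmaps : MapsTo g rightHalfPlane rightHalfPlane)
    (hs : ∀ z ∈ rightHalfPlane, ∀ w ∈ rightHalfPlane,
      f z * (1 + z * g w) ^ (ℓ + 2) = f w * (1 + w * g z) ^ (ℓ + 2))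
    {w₀ : ℂ} (hw₀ : w₀ ∈ rightHalfPlane) (hf₀ : f w₀ ≠ 0) :
    ∃ p q t R : ℂ, ∀ w ∈ rightHalfPlane, t + p * w ≠ 0 ∧ (t + p * w) * g w = p + q * w ∧
      f w * (t + p * w) ^ (ℓ + 2) = R := by
  have h1 := one_mem_rightHalfPlane
  have hf1 : f 1 ≠ 0 := by
    intro h0
    have h2 := hs 1 h1 w₀ hw₀
    rw [h0, zero_mul] at h2
    exact mul_ne_zero hf₀ (pow_ne_zero _ (one_add_mul_ne_zero hw₀ (hgmaps h1))) h2.symm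
  have hnhds : rightHalfPlane ∈ nhds (1 : ℂ) := isOpen_rightHalfPlane.mem_nhds h1
  have hf' := (hf.differentiableAt hnhds).hasDerivAt
  have hg' := (hg.differentiableAt hnhds).hasDerivAt
  set φ : ℂ := deriv f 1
  set a : ℂ := deriv g 1
  set β : ℂ := g 1 with hβ
  have hβmem : β ∈ rightHalfPlane := hgmaps h1
  have hβ1 : 1 + β ≠ 0 := by simpa using one_add_mul_ne_zero h1 hβmem
  have hN : (ℓ : ℂ) + 2 ≠ 0 := by exact_mod_cast (Nat.succ_ne_zero (ℓ + 1))
  -- Differentiate the identity in z at 1, then use the identity at z = 1 itself to eliminate f(w).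
  have key : ∀ w ∈ rightHalfPlane,
      φ * (1 + g w) * (1 + w * β) + f 1 * (ℓ + 2) * g w * (1 + w * β) =
        (ℓ + 2) * w * a * f 1 * (1 + g w) := by
    intro w hw
    have hgw : 1 + g w ≠ 0 := by simpa using one_add_mul_ne_zero h1 (hgmaps hw)
    have hA : HasDerivAt (fun z => f z * (1 + z * g w) ^ (ℓ + 2))
        (φ * (1 + 1 * g w) ^ (ℓ + 2) +
          f 1 * (((ℓ + 2 : ℕ) : ℂ) * (1 + 1 * g w) ^ (ℓ + 2 - 1) * (1 * g w))) 1 :=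
      hf'.mul ((((hasDerivAt_id (1 : ℂ)).mul_const (g w)).const_add 1).pow (ℓ + 2))
    have hB : HasDerivAt (fun z => f w * (1 + w * g z) ^ (ℓ + 2))
        (f w * (((ℓ + 2 : ℕ) : ℂ) * (1 + w * β) ^ (ℓ + 2 - 1) * (w * a))) 1 :=
      (((hg'.const_mul w).const_add 1).pow (ℓ + 2)).const_mul (f w)
    have hAB := hA.unique (hB.congr_of_eventuallyEq
      (Filter.eventually_of_mem hnhds fun z hz => hs z hz w hw))
    have h0 := hs 1 h1 w hw
    rw [← hβ] at h0
    simp only [one_mul, show ℓ + 2 - 1 = ℓ + 1 from rfl] at hAB h0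
    push_cast at hAB
    refine mul_left_cancel₀ (pow_ne_zero (ℓ + 1) hgw) ?_
    linear_combination (1 + w * β) * hAB - (ℓ + 2) * w * a * h0
  -- The case w = 1 expresses f'(1) through g(1) and g'(1); substituting it back makes g linear
  -- fractional.
  have key1 : φ * (1 + β) + f 1 * (ℓ + 2) * β = (ℓ + 2) * a * f 1 := by
    have := key 1 h1
    rw [← hβ] at this
    refine mul_right_cancel₀ hβ1 ?_
    linear_combination this
  have heq : ∀ w ∈ rightHalfPlane, (1 + a + (β - a) * w) * g w = (β - a) + (β ^ 2 + a) * w := by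
    intro w hw
    refine mul_left_cancel₀ (mul_ne_zero hf1 hN) ?_
    linear_combination (1 + β) * key w hw - (1 + g w) * (1 + w * β) * key1
  -- The right side never vanishes, hence neither does the denominator of g; it also converts f into
  -- a power of that denominator.
  have hne : ∀ w ∈ rightHalfPlane,
      (1 + a + (β - a) * w) * (1 + g w) = (1 + β) * (1 + w * β) := by
    intro w hw
    linear_combination heq w hw
  refine ⟨β - a, β ^ 2 + a, 1 + a, f 1 * (1 + β) ^ (ℓ + 2), fun w hw => ⟨?_, heq w hw, ?_⟩⟩
  · intro h0
    have h2 := hne w hw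
    rw [h0, zero_mul] at h2
    exact mul_ne_zero hβ1 (one_add_mul_ne_zero hw hβmem) h2.symm
  · have hgw : 1 + g w ≠ 0 := by simpa using one_add_mul_ne_zero h1 (hgmaps hw)
    have h0 := hs 1 h1 w hw
    rw [← hβ, one_mul] at h0
    refine mul_left_cancel₀ (pow_ne_zero (ℓ + 2) (one_add_mul_ne_zero hw hβmem)) ?_
    have h2 := congrArg (· ^ (ℓ + 2)) (hne w hw)
    simp only [mul_pow] at h2
    linear_combination (-(1 + a + (β - a) * w) ^ (ℓ + 2)) * h0 + f 1 * h2

theorem re_pos_and_im_eq_zero_of_mapsTo_mul {a : ℂ}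
    (H : ∀ w ∈ rightHalfPlane, 0 < (a * w).re) : 0 < a.re ∧ a.im = 0 := by
  have H' : ∀ y : ℝ, 0 < a.re - a.im * y := fun y => by
    have := H ⟨1, y⟩ (by simp [rightHalfPlane])
    simpa using this
  refine ⟨by simpa using H' 0, ?_⟩
  by_contra hne
  -- At w = 1 + i Re a / Im a the real part of a w would be zero.
  have := H' (a.re / a.im)
  rw [mul_div_cancel₀ _ hne] at this
  linarith

/-- For p = 0 the map is a dilation; otherwise divide by p. The separate constant case is never
produced, since a constant g appears in the last form with δκ = 1. -/
theorem starSymbol_of_moebius (hgmaps : MapsTo g rightHalfPlane rightHalfPlane) {p q t R : ℂ}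
    (H : ∀ w ∈ rightHalfPlane, t + p * w ≠ 0 ∧ (t + p * w) * g w = p + q * w ∧
      f w * (t + p * w) ^ (ℓ + 2) = R) : StarSymbol ℓ f g := by
  by_cases hp : p = 0
  · subst hp
    simp only [zero_mul, add_zero, zero_add] at H
    have ht : t ≠ 0 := (H 1 one_mem_rightHalfPlane).1
    have hgw : ∀ w ∈ rightHalfPlane, g w = q / t * w := fun w hw => by
      have := (H w hw).2.1
      field_simp
      linear_combination this
    obtain ⟨h1, h2⟩ := re_pos_and_im_eq_zero_of_mapsTo_mul (a := q / t) fun w hw => by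
      rw [← hgw w hw]
      exact hgmaps hw
    refine Or.inr (Or.inr (Or.inl ⟨(q / t).re, R / t ^ (ℓ + 2), h1, fun w hw => ⟨?_, ?_⟩⟩))
    · rw [hgw w hw]
      congr 1
      exact Complex.ext rfl (by simpa using h2)
    · rw [eq_div_iff (pow_ne_zero _ ht)]
      exact (H w hw).2.2
  · have hden : ∀ w ∈ rightHalfPlane, w + t / p ≠ 0 := fun w hw h0 => (H w hw).1 <| by
      have : t + p * w = p * (w + t / p) := by field_simp; ring
      rw [this, h0, mul_zero]
    have hgw : ∀ w ∈ rightHalfPlane, g w = (1 - q / p * (t / p)) / (w + t / p) + q / p := by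
      intro w hw
      have h1 := hden w hw
      have h2 := (H w hw).2.1
      rw [div_add' _ _ _ h1, eq_div_iff h1]
      refine mul_left_cancel₀ hp ?_
      linear_combination h2 + g w * mul_div_cancel₀ t hp - w * mul_div_cancel₀ q hp
    -- Otherwise the pole -t/p would lie in the half-plane.
    have hκ : 0 ≤ (t / p).re := by
      by_contra hlt
      refine hden (-(t / p)) ?_ (by ring)
      change 0 < (-(t / p)).re
      rw [Complex.neg_re]
      linarith
    refine Or.inr (Or.inr (Or.inr ⟨q / p, t / p, R / p ^ (ℓ + 2), ?_, fun w hw => ⟨hgw w hw, ?_⟩⟩))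
    · refine moebiusCond_of_mapsTo hκ fun u hu => ?_
      have hm : u - t / p ∈ rightHalfPlane := by
        change 0 < (u - t / p).re
        rw [Complex.sub_re]
        linarith
      have := hgmaps hm
      rw [hgw _ hm, sub_add_cancel] at this
      exact this
    · have h1 := hden w hw
      rw [div_div, ← mul_pow, eq_div_iff (pow_ne_zero _ (mul_ne_zero hp h1)), ← (H w hw).2.2]
      congr 2
      field_simp
      ring

theorem kernel_symm_of_moebius {p q t R : ℂ}
    (H : ∀ w ∈ rightHalfPlane, t + p * w ≠ 0 ∧ (t + p * w) * g w = p + q * w ∧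
      f w * (t + p * w) ^ (ℓ + 2) = R) {z w : ℂ} (hz : z ∈ rightHalfPlane)
    (hw : w ∈ rightHalfPlane) :
    f z * (1 + z * g w) ^ (ℓ + 2) = f w * (1 + w * g z) ^ (ℓ + 2) := by
  obtain ⟨hz0, hz1, hz2⟩ := H z hz
  obtain ⟨hw0, hw1, hw2⟩ := H w hw
  refine mul_left_cancel₀ (pow_ne_zero (ℓ + 2) (mul_ne_zero hz0 hw0)) ?_
  -- Both sides equal t + p (z + w) + q z w, which is symmetric because p occurs twice in the
  -- coefficient matrix.
  have e1 : (t + p * w) * (1 + z * g w) = (t + p * z) * (1 + w * g z) := by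
    linear_combination z * hw1 - w * hz1
  have e2 := congrArg (· ^ (ℓ + 2)) e1
  simp only [mul_pow] at e2 ⊢
  linear_combination (f z * (t + p * z) ^ (ℓ + 2)) * e2 +
    (t + p * z) ^ (ℓ + 2) * (1 + w * g z) ^ (ℓ + 2) * (hz2 - hw2)

theorem StarSymbol.kernel_symm (h : StarSymbol ℓ f g) :
    ∀ z ∈ rightHalfPlane, ∀ w ∈ rightHalfPlane,
      f z * (1 + z * g w) ^ (ℓ + 2) = f w * (1 + w * g z) ^ (ℓ + 2) := by
  rcases h with h | ⟨α, β, hα, h⟩ | ⟨lam, θ, -, h⟩ | ⟨δ, κ, r, hc, h⟩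
  · intro z hz w hw
    rw [h z hz, h w hw, zero_mul, zero_mul]
  -- The constant α is written as (α + α² w)/(1 + α w).
  · refine fun z hz w hw => kernel_symm_of_moebius (p := α) (q := α ^ 2) (t := 1) (R := β) ?_ hz hw
    intro w hw
    have h1 := one_add_mul_ne_zero hα hw
    refine ⟨h1, ?_, ?_⟩
    · rw [(h w hw).1]
      ring
    · rw [(h w hw).2, div_mul_cancel₀ _ (pow_ne_zero _ h1)]
  · intro z hz w hw
    rw [(h z hz).1, (h z hz).2, (h w hw).1, (h w hw).2]
    ring
  · refine fun z hz w hw => kernel_symm_of_moebius (p := 1) (q := δ) (t := κ) (R := r) ?_ hz hw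
    intro w hw
    have hw' : 0 < w.re := hw
    have h1 : w + κ ≠ 0 := ne_zero_of_re_pos (by rw [Complex.add_re]; linarith [hc.re_nonneg])
    have h2 : κ + 1 * w = w + κ := by ring
    rw [h2]
    refine ⟨h1, ?_, ?_⟩
    · rw [(h w hw).1]
      field_simp
      ring
    · rw [(h w hw).2, div_mul_cancel₀ _ (pow_ne_zero _ h1)]

theorem IsConjSelfAdjoint.starSymbol (hf : DifferentiableOn ℂ f rightHalfPlane)
    (hg : DifferentiableOn ℂ g rightHalfPlane) (hgmaps : MapsTo g rightHalfPlane rightHalfPlane)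
    (H : IsConjSelfAdjoint (bergmanC ℓ) (wcoMax ℓ f g)) : StarSymbol ℓ f g := by
  by_cases h0 : ∀ w ∈ rightHalfPlane, f w = 0
  · exact Or.inl h0
  · push Not at h0
    obtain ⟨w₀, hw₀, hf₀⟩ := h0
    obtain ⟨p, q, t, R, hM⟩ := exists_moebius_of_kernel_symm hf hg hgmaps
      (fun z hz w hw => H.kernel_symm hgmaps hz hw) hw₀ hf₀
    exact starSymbol_of_moebius hgmaps hM

end Moebius

/-! ### Boundedness of the listed operators -/

section Boundedness

variable {ℓ : ℕ} {f g : ℂ → ℂ}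

theorem isBoundedPMap_wcoMax (L : ℝ)
    (H : ∀ h : Bergman ℓ, ∃ k : Bergman ℓ, (∀ z ∈ rightHalfPlane, k z = f z * h (g z)) ∧
      ‖k‖ ≤ L * ‖h‖) : IsBoundedPMap (wcoMax ℓ f g) := by
  refine ⟨?_, max L 1, by positivity, fun x => ?_⟩
  · rw [eq_top_iff]
    intro h _
    obtain ⟨k, hk, -⟩ := H h
    obtain ⟨x, hx, -⟩ := (LinearPMap.mem_graph_iff _).1 (mem_graph_wcoMax_iff.2 hk)
    have hx' : (x : Bergman ℓ) = h := hx
    exact hx' ▸ x.2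
  · obtain ⟨k, hk, hkL⟩ := H x
    have h1 := LinearPMap.mem_graph_snd_inj _ (LinearPMap.mem_graph _ x)
      (mem_graph_wcoMax_iff.2 hk) rfl
    rw [h1]
    exact hkL.trans (mul_le_mul_of_nonneg_right (le_max_left _ _) (norm_nonneg _))

/-- The operator is h ↦ h(α) k, and point evaluations are bounded. -/
theorem isBoundedPMap_of_const {α : ℂ} (hα : α ∈ rightHalfPlane) (k : Bergman ℓ)
    (hf : ∀ z ∈ rightHalfPlane, f z = k z) (hg : ∀ z ∈ rightHalfPlane, g z = α) :
    IsBoundedPMap (wcoMax ℓ f g) := by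
  refine isBoundedPMap_wcoMax (‖Bergman.ker ℓ α hα‖ * ‖k‖) fun h => ⟨h α • k, fun z hz => ?_, ?_⟩
  · rw [hf z hz, hg z hz, Bergman.coe_smul, Pi.smul_apply, smul_eq_mul, mul_comm]
  · rw [norm_smul, mul_right_comm]
    exact mul_le_mul_of_nonneg_right (Bergman.norm_apply_le hα h) (norm_nonneg k)

/-- Boundedness by change of variables along an injective symbol. -/
theorem isBoundedPMap_of_injOn (hf : DifferentiableOn ℂ f rightHalfPlane)
    (hgmaps : MapsTo g rightHalfPlane rightHalfPlane) (g' : ℂ → ℂ)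
    (hg' : ∀ z ∈ rightHalfPlane, HasDerivAt g (g' z) z) (hinj : InjOn g rightHalfPlane) {L : ℝ}
    (hL0 : 0 ≤ L)
    (hL : ∀ z ∈ rightHalfPlane, z.re ^ ℓ * ‖f z‖ ^ 2 ≤ L * (‖g' z‖ ^ 2 * (g z).re ^ ℓ)) :
    IsBoundedPMap (wcoMax ℓ f g) := by
  have hms : MeasurableSet rightHalfPlane := isOpen_rightHalfPlane.measurableSet
  refine isBoundedPMap_wcoMax (√L) fun h => ?_
  have hgd : DifferentiableOn ℂ g rightHalfPlane := fun z hz =>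
    (hg' z hz).differentiableAt.differentiableWithinAt
  have hdiff : DifferentiableOn ℂ (fun z => f z * h (g z)) rightHalfPlane :=
    hf.mul (h.differentiableOn.comp hgd hgmaps)
  have hderiv := fun z (hz : z ∈ rightHalfPlane) =>
    (hg' z hz).hasFDerivWithinAt_real (s := rightHalfPlane)
  have himg : IntegrableOn (fun z : ℂ => z.re ^ ℓ * ‖h z‖ ^ 2) (g '' rightHalfPlane) :=
    h.integrableOn.mono_set hgmaps.image_subset
  have hint := (integrableOn_image_iff_integrableOn_abs_det_fderiv_smul volume hms hderiv hinj
    (fun z : ℂ => z.re ^ ℓ * ‖h z‖ ^ 2)).1 himg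
  -- The weight comparison dominates the integrand by the Jacobian integrand of h over g(Π), whose
  -- integral is at most that over Π.
  have hpt : ∀ z ∈ rightHalfPlane, z.re ^ ℓ * ‖f z * h (g z)‖ ^ 2 ≤
      L * (|((ContinuousLinearMap.toSpanSingleton ℂ (g' z)).restrictScalars ℝ
        : ℂ →L[ℝ] ℂ).det| • ((g z).re ^ ℓ * ‖h (g z)‖ ^ 2)) := by
    intro z hz
    rw [det_restrictScalars_toSpanSingleton, abs_of_nonneg (by positivity), norm_mul, mul_pow,
      smul_eq_mul]
    have := mul_le_mul_of_nonneg_right (hL z hz) (sq_nonneg ‖h (g z)‖)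
    linarith
  have hI : IntegrableOn (fun z => z.re ^ ℓ * ‖f z * h (g z)‖ ^ 2) rightHalfPlane := by
    refine Integrable.mono' (hint.const_mul L) ?_ ?_
    · refine ContinuousOn.aestronglyMeasurable ?_ hms
      exact (Complex.continuous_re.pow ℓ).continuousOn.mul (hdiff.continuousOn.norm.pow 2)
    · refine (ae_restrict_iff' hms).2 (Filter.Eventually.of_forall fun z hz => ?_)
      have hz' : 0 < z.re := hz
      rw [Real.norm_of_nonneg (by positivity)]
      exact hpt z hz
  have hmem : rightHalfPlane.indicator (fun z => f z * h (g z)) ∈ bergmanSubmodule ℓ := by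
    refine ⟨hdiff.congr fun z hz => indicator_of_mem hz _, fun z hz => indicator_of_notMem hz _,
      hI.congr_fun (fun z hz => ?_) hms⟩
    simp only
    rw [indicator_of_mem hz]
  refine ⟨Bergman.mk _ hmem, fun z hz =>
    indicator_of_mem hz (fun z => f z * h (g z)), ?_⟩
  refine le_of_sq_le_sq ?_ (by positivity)
  rw [mul_pow, Real.sq_sqrt hL0, Bergman.norm_sq_eq, Bergman.norm_sq_eq, mul_left_comm]
  refine mul_le_mul_of_nonneg_left ?_ (by positivity)
  calc ∫ z in rightHalfPlane, z.re ^ ℓ * ‖(Bergman.mk _ hmem : Bergman ℓ) z‖ ^ 2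
      = ∫ z in rightHalfPlane, z.re ^ ℓ * ‖f z * h (g z)‖ ^ 2 := by
        refine setIntegral_congr_fun hms fun z hz => ?_
        change z.re ^ ℓ * ‖rightHalfPlane.indicator (fun z => f z * h (g z)) z‖ ^ 2 = _
        rw [indicator_of_mem hz]
    _ ≤ ∫ z in rightHalfPlane, L * (|((ContinuousLinearMap.toSpanSingleton ℂ
        (g' z)).restrictScalars ℝ : ℂ →L[ℝ] ℂ).det| • ((g z).re ^ ℓ * ‖h (g z)‖ ^ 2)) :=
        setIntegral_mono_on hI (hint.const_mul L) hms hpt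
    _ = L * ∫ z in g '' rightHalfPlane, z.re ^ ℓ * ‖h z‖ ^ 2 := by
        rw [integral_const_mul, integral_image_eq_integral_abs_det_fderiv_smul volume hms hderiv
          hinj]
    _ ≤ L * ∫ z in rightHalfPlane, z.re ^ ℓ * ‖h z‖ ^ 2 := by
        refine mul_le_mul_of_nonneg_left ?_ hL0
        refine setIntegral_mono_set h.integrableOn ?_ hgmaps.image_subset.eventuallyLE
        refine (ae_restrict_iff' hms).2 (Filter.Eventually.of_forall fun z hz => ?_)
        have hz' : 0 < z.re := hz
        simp only [Pi.zero_apply]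
        positivity

theorem isBoundedPMap_of_dilation {lam : ℝ} (hlam : 0 < lam) {θ : ℂ}
    (hgmaps : MapsTo g rightHalfPlane rightHalfPlane)
    (h : ∀ w ∈ rightHalfPlane, g w = lam * w ∧ f w = θ) : IsBoundedPMap (wcoMax ℓ f g) := by
  have hlam' : (lam : ℂ) ≠ 0 := by exact_mod_cast hlam.ne'
  refine isBoundedPMap_of_injOn (L := ‖θ‖ ^ 2 / lam ^ (ℓ + 2))
    ((differentiableOn_const θ).congr fun w hw => (h w hw).2) hgmaps (fun _ => lam)
    (fun z hz => ?_) ?_ (by positivity) fun z hz => ?_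
  · have h1 : HasDerivAt (fun w : ℂ => (lam : ℂ) * w) lam z := by
      simpa using (hasDerivAt_id z).const_mul (lam : ℂ)
    exact h1.congr_of_eventuallyEq (Filter.eventually_of_mem (isOpen_rightHalfPlane.mem_nhds hz)
      fun w hw => (h w hw).1)
  · intro z hz w hw hzw
    rw [(h z hz).1, (h w hw).1] at hzw
    exact mul_left_cancel₀ hlam' hzw
  · rw [(h z hz).1, (h z hz).2, Complex.re_ofReal_mul, Complex.norm_real,
      Real.norm_of_nonneg hlam.le]
    refine le_of_eq ?_
    rw [mul_pow]
    field_simp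
    ring

theorem isBoundedPMap_of_moebius {δ κ r : ℂ} (hc : MoebiusCond δ κ)
    (hgmaps : MapsTo g rightHalfPlane rightHalfPlane)
    (h : ∀ w ∈ rightHalfPlane, g w = (1 - δ * κ) / (w + κ) + δ ∧ f w = r / (w + κ) ^ (ℓ + 2)) :
    IsBoundedPMap (wcoMax ℓ f g) := by
  have hden : ∀ w ∈ rightHalfPlane, w + κ ≠ 0 := fun w hw => by
    have hw' : 0 < w.re := hw
    exact ne_zero_of_re_pos (by rw [Complex.add_re]; linarith [hc.re_nonneg])
  by_cases hD : 1 - δ * κ = 0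
  · have hgδ : ∀ w ∈ rightHalfPlane, g w = δ := fun w hw => by
      rw [(h w hw).1, hD, zero_div, zero_add]
    have hδ : δ ∈ rightHalfPlane := by
      rw [← hgδ 1 one_mem_rightHalfPlane]
      exact hgmaps one_mem_rightHalfPlane
    have hδ0 := ne_zero_of_mem_rightHalfPlane hδ
    have hc1 : (2 : ℂ) ^ ℓ * ((ℓ : ℂ) + 1) ≠ 0 :=
      mul_ne_zero (pow_ne_zero _ two_ne_zero) (by exact_mod_cast Nat.succ_ne_zero ℓ)
    refine isBoundedPMap_of_const hδ
      ((r * δ ^ (ℓ + 2) / (2 ^ ℓ * ((ℓ : ℂ) + 1))) • bergmanC ℓ (Bergman.ker ℓ δ hδ))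
      (fun z hz => ?_) hgδ
    -- Since δκ = 1, the weight f is a multiple of C⋆ K_δ.
    have h1 : 1 + z * δ = δ * (z + κ) := by linear_combination hD
    have h2 := hden z hz
    rw [(h z hz).2, Bergman.coe_smul, Pi.smul_apply, conj_kernel_apply hδ hz, h1, mul_pow,
      smul_eq_mul]
    field_simp
  · have hnD : 0 < ‖1 - δ * κ‖ := norm_pos_iff.2 hD
    -- Here |f|² equals this constant times |g'|^(ℓ+2), and ℓ of those factors are absorbed by
    -- Schwarz–Pick.
    refine isBoundedPMap_of_injOn (L := ‖r‖ ^ 2 / ‖1 - δ * κ‖ ^ (ℓ + 2)) ?_ hgmaps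
      (fun z => -(1 - δ * κ) / (z + κ) ^ 2) (fun z hz => ?_) ?_ (by positivity) fun z hz => ?_
    · refine DifferentiableOn.congr (f := fun w => r / (w + κ) ^ (ℓ + 2)) ?_
        fun w hw => (h w hw).2
      exact (differentiableOn_const _).div (by fun_prop) fun w hw => pow_ne_zero _ (hden w hw)
    · have h1 : HasDerivAt (fun w => (1 - δ * κ) / (w + κ) + δ) (-(1 - δ * κ) / (z + κ) ^ 2) z := by
        have h2 := (((hasDerivAt_id z).add_const κ).inv (hden z hz)).const_mul (1 - δ * κ)
        have h3 := h2.add_const δ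
        refine h3.congr_deriv ?_
        simp only [id]
        ring
      exact h1.congr_of_eventuallyEq (Filter.eventually_of_mem
        (isOpen_rightHalfPlane.mem_nhds hz) fun w hw => (h w hw).1)
    · intro z hz w hw hzw
      rw [(h z hz).1, (h w hw).1, add_left_inj, div_eq_div_iff (hden z hz) (hden w hw)] at hzw
      have := mul_left_cancel₀ hD hzw
      linear_combination -this
    · have hz' : 0 < z.re := hz
      have h1 := hc.norm_mul_re_le hz
      have hu : 0 < ‖z + κ‖ := norm_pos_iff.2 (hden z hz)
      rw [← (h z hz).1, Complex.normSq_eq_norm_sq, ← div_le_iff₀ (by positivity)] at h1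
      have h2 := pow_le_pow_left₀ (by positivity) h1 ℓ
      rw [(h z hz).2, norm_div, norm_div, norm_neg, norm_pow, norm_pow]
      generalize ‖1 - δ * κ‖ = d at hnD h1 h2 ⊢
      calc z.re ^ ℓ * (‖r‖ / ‖z + κ‖ ^ (ℓ + 2)) ^ 2
          = ‖r‖ ^ 2 / d ^ (ℓ + 2) * ((d / ‖z + κ‖ ^ 2) ^ 2 *
            (d * z.re / ‖z + κ‖ ^ 2) ^ ℓ) := by
            simp only [div_pow, mul_pow]
            field_simp
            ring
        _ ≤ _ := by gcongr

theorem StarSymbol.isBoundedPMap (hgmaps : MapsTo g rightHalfPlane rightHalfPlane)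
    (h : StarSymbol ℓ f g) : IsBoundedPMap (wcoMax ℓ f g) := by
  rcases h with h | ⟨α, β, hα, h⟩ | ⟨lam, θ, hlam, h⟩ | ⟨δ, κ, r, hc, h⟩
  · refine isBoundedPMap_wcoMax 0 fun k => ⟨0, fun z hz => ?_, by simp⟩
    rw [h z hz, zero_mul]
    rfl
  · have hc1 : (2 : ℂ) ^ ℓ * ((ℓ : ℂ) + 1) ≠ 0 :=
      mul_ne_zero (pow_ne_zero _ two_ne_zero) (by exact_mod_cast Nat.succ_ne_zero ℓ)
    refine isBoundedPMap_of_const hα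
      ((β / (2 ^ ℓ * ((ℓ : ℂ) + 1))) • bergmanC ℓ (Bergman.ker ℓ α hα))
      (fun z hz => ?_) fun z hz => (h z hz).1
    have h1 := one_add_mul_ne_zero hz hα
    rw [(h z hz).2, Bergman.coe_smul, Pi.smul_apply, conj_kernel_apply hα hz, smul_eq_mul,
      mul_comm α]
    field_simp
  · exact isBoundedPMap_of_dilation hlam hgmaps h
  · exact isBoundedPMap_of_moebius hc hgmaps h

theorem isConjSelfAdjoint_bergmanC_iff (hf : DifferentiableOn ℂ f rightHalfPlane)
    (hg : DifferentiableOn ℂ g rightHalfPlane) (hgmaps : MapsTo g rightHalfPlane rightHalfPlane) :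
    IsConjSelfAdjoint (bergmanC ℓ) (wcoMax ℓ f g) ↔ StarSymbol ℓ f g :=
  ⟨fun H => H.starSymbol hf hg hgmaps, fun H =>
    isConjSelfAdjoint_of_bounded hgmaps (H.isBoundedPMap hgmaps) H.kernel_symm⟩

end Boundedness

/-! ### Transport under unitary conjugation -/

section Transport

variable {E : Type*} [NormedAddCommGroup E] [InnerProductSpace ℂ E]

theorem mem_graph_unitaryConj_iff (U : E ≃ₗᵢ[ℂ] E) (T : E →ₗ.[ℂ] E) {x y : E} :
    (x, y) ∈ (unitaryConj U T).graph ↔ (U x, U y) ∈ T.graph := by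
  rw [LinearPMap.mem_graph_iff, LinearPMap.mem_graph_iff]
  constructor
  · rintro ⟨v, rfl, rfl⟩
    exact ⟨⟨U v, v.2⟩, rfl, (U.apply_symm_apply _).symm⟩
  · rintro ⟨v, hv, hy⟩
    have hv' : (v : E) = U x := hv
    have hx : x ∈ (unitaryConj U T).domain := by
      change U x ∈ T.domain
      exact hv' ▸ v.2
    refine ⟨⟨x, hx⟩, rfl, ?_⟩
    have h1 : (⟨U x, hx⟩ : T.domain) = v := Subtype.ext hv'.symm
    change U.symm (T ⟨U x, hx⟩) = y
    rw [h1, hy, U.symm_apply_apply]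

theorem mem_graph_adjoint_unitaryConj_iff (U : E ≃ₗᵢ[ℂ] E) (T : E →ₗ.[ℂ] E) {x y : E} :
    (x, y) ∈ (unitaryConj U T).graph.adjoint ↔ (U x, U y) ∈ T.graph.adjoint := by
  rw [Submodule.mem_adjoint_iff, Submodule.mem_adjoint_iff, iff_comm, U.surjective.forall]
  refine forall_congr' fun a => ?_
  rw [U.surjective.forall]
  refine forall_congr' fun d => ?_
  rw [mem_graph_unitaryConj_iff, U.inner_map_map, U.inner_map_map]

/-- The hypothesis `hJ` says J' = U J U*. Graphs and adjoint graphs are carried by U, which is also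
a homeomorphism, so each clause transfers. -/
theorem isConjSelfAdjoint_unitaryConj_iff (U : E ≃ₗᵢ[ℂ] E) (J J' : E ≃ₗᵢ⋆[ℂ] E)
    (hJ : ∀ x, J' (U x) = U (J x)) (T : E →ₗ.[ℂ] E) :
    IsConjSelfAdjoint J' T ↔ IsConjSelfAdjoint J (unitaryConj U T) := by
  refine and_congr ?_ ?_
  · have h1 : ((unitaryConj U T).domain : Set E) = U.toHomeomorph ⁻¹' (T.domain : Set E) := rfl
    rw [h1, dense_iff_closure_eq, dense_iff_closure_eq, ← U.toHomeomorph.preimage_closure,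
      preimage_eq_univ_iff, U.toHomeomorph.surjective.range_eq, univ_subset_iff]
  · rw [U.surjective.forall]
    refine forall_congr' fun u => ?_
    rw [U.surjective.forall]
    refine forall_congr' fun v => ?_
    rw [mem_graph_unitaryConj_iff, U.surjective.exists]
    simp only [hJ, mem_graph_adjoint_unitaryConj_iff, U.injective.eq_iff]

theorem IsBoundedPMap.of_unitaryConj {U : E ≃ₗᵢ[ℂ] E} {T : E →ₗ.[ℂ] E}
    (h : IsBoundedPMap (unitaryConj U T)) : IsBoundedPMap T := by
  obtain ⟨hd, L, hL, hb⟩ := h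
  have hmem : ∀ x : E, U.symm x ∈ (unitaryConj U T).domain := fun x => hd ▸ Submodule.mem_top
  have hmem' : ∀ x : E, x ∈ T.domain := fun x => by
    have h1 : U (U.symm x) ∈ T.domain := hmem x
    rwa [U.apply_symm_apply] at h1
  refine ⟨eq_top_iff.2 fun x _ => hmem' x, L, hL, fun x => ?_⟩
  have h1 := hb ⟨U.symm x, hmem x⟩
  have h2 : unitaryConj U T ⟨U.symm x, hmem x⟩ = U.symm (T x) := by
    change U.symm (T ⟨U (U.symm x), _⟩) = U.symm (T x)
    congr 2
    exact Subtype.ext (U.apply_symm_apply _)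
  rw [h2, U.symm.norm_map] at h1
  simpa using h1

end Transport

/-! ### Affine change of variable and the main theorem -/

theorem forall_mem_rightHalfPlane_affine {s : ℝ} (hs : 0 < s) (c : ℝ) {P : ℂ → Prop} :
    (∀ z ∈ rightHalfPlane, P z) ↔ ∀ w ∈ rightHalfPlane, P ((s : ℂ) * w + Complex.I * c) := by
  conv_lhs => rw [← image_affine_rightHalfPlane hs c]
  exact forall_mem_image

theorem inv_mul_affine_sub {s : ℝ} (hs : 0 < s) (c : ℝ) (w : ℂ) :
    (s : ℂ)⁻¹ * ((s : ℂ) * w + Complex.I * c - Complex.I * c) = w := by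
  have : (s : ℂ) ≠ 0 := by exact_mod_cast hs.ne'
  rw [add_sub_cancel_right, inv_mul_cancel_left₀ this]

theorem mul_add_eq_iff {s : ℂ} (hs : s ≠ 0) (x y a : ℂ) : s * x + a = y ↔ x = s⁻¹ * (y - a) := by
  rw [eq_inv_mul_iff_mul_eq₀ hs, eq_sub_iff_add_eq]

/-- At z = s w + i c the two pointwise graph conditions differ only by the factor b. Equality of
graphs includes equality of domains. -/
theorem wcoMax_conj_eq (ℓ : ℕ) (b : ℂ) (hb : b ≠ 0) (c : ℝ) (f g : ℂ → ℂ) :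
    wcoMax ℓ (fun z => f ((dil ℓ b : ℂ)⁻¹ * (z - Complex.I * c)))
        (fun z => (dil ℓ b : ℂ) * g ((dil ℓ b : ℂ)⁻¹ * (z - Complex.I * c)) + Complex.I * c) =
      unitaryConj (bergmanU ℓ b hb c) (wcoMax ℓ f g) := by
  refine LinearPMap.eq_of_eq_graph (Submodule.ext fun ⟨h, k⟩ => ?_)
  rw [mem_graph_unitaryConj_iff, mem_graph_wcoMax_iff, mem_graph_wcoMax_iff,
    forall_mem_rightHalfPlane_affine (dil_pos ℓ hb) c]
  refine forall₂_congr fun w _ => ?_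
  rw [inv_mul_affine_sub (dil_pos ℓ hb), bergmanU_apply, bergmanU_apply, mul_left_comm,
    mul_right_inj' hb]

theorem mainTheorem8 (ℓ : ℕ) (b : ℂ) (hb : b ≠ 0) (c : ℝ) (f g : ℂ → ℂ)
    (hf : DifferentiableOn ℂ f rightHalfPlane) (hg : DifferentiableOn ℂ g rightHalfPlane)
    (hgmaps : MapsTo g rightHalfPlane rightHalfPlane) :
    wcoMax ℓ (fun z => f ((dil ℓ b : ℂ)⁻¹ * (z - Complex.I * c)))
        (fun z => (dil ℓ b : ℂ) * g ((dil ℓ b : ℂ)⁻¹ * (z - Complex.I * c)) + Complex.I * c) =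
      unitaryConj (bergmanU ℓ b hb c) (wcoMax ℓ f g) ∧
    List.TFAE [
      IsConjSelfAdjoint (bergmanUCU ℓ b hb c) (wcoMax ℓ f g),
      IsConjSelfAdjoint (bergmanC ℓ) (unitaryConj (bergmanU ℓ b hb c) (wcoMax ℓ f g)),
      (∀ w ∈ rightHalfPlane, f w = 0) ∨
      (∃ α β : ℂ, α ∈ rightHalfPlane ∧
        (∀ w ∈ rightHalfPlane,
          g w = (dil ℓ b : ℂ)⁻¹ * (α - Complex.I * c) ∧
          f w = β / (1 + α * ((dil ℓ b : ℂ) * w + Complex.I * c)) ^ (ℓ + 2))) ∨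
      (∃ (lam : ℝ) (θ : ℂ), 0 < lam ∧
        (∀ w ∈ rightHalfPlane,
          g w = lam * (w + Complex.I * c * (dil ℓ b : ℂ)⁻¹) - Complex.I * c * (dil ℓ b : ℂ)⁻¹ ∧
          f w = θ)) ∨
      (∃ δ κ r : ℂ,
        ((δ.re = 0 ∧ (δ * κ).im = 0 ∧ (δ * κ).re < 1 ∧ 0 ≤ κ.re) ∨
          (-δ.re < 0 ∧ 0 ≤ κ.re - ((δ * κ - 1).re + ‖δ * κ - 1‖) / (2 * δ.re))) ∧
        (∀ w ∈ rightHalfPlane,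
          g w = (dil ℓ b : ℂ)⁻¹ *
            ((1 - δ * κ) / ((dil ℓ b : ℂ) * w + Complex.I * c + κ) + δ - Complex.I * c) ∧
          f w = r / ((dil ℓ b : ℂ) * w + Complex.I * c + κ) ^ (ℓ + 2)))] ∧
    (IsConjSelfAdjoint (bergmanUCU ℓ b hb c) (wcoMax ℓ f g) → IsBoundedPMap (wcoMax ℓ f g)) := by
  
  have hs := dil_pos ℓ hb
  have hs0 : (dil ℓ b : ℂ) ≠ 0 := by exact_mod_cast hs.ne'
  have hU := wcoMax_conj_eq ℓ b hb c f g
  have haff : ∀ z ∈ rightHalfPlane, (dil ℓ b : ℂ) * z + Complex.I * c ∈ rightHalfPlane :=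
    fun z hz => by
      rw [← image_affine_rightHalfPlane hs c]
      exact mem_image_of_mem _ hz
  have hinv : MapsTo (fun z : ℂ => (dil ℓ b : ℂ)⁻¹ * (z - Complex.I * c)) rightHalfPlane
      rightHalfPlane := by
    refine (forall_mem_rightHalfPlane_affine hs c).2 fun w hw => ?_
    beta_reduce
    rwa [inv_mul_affine_sub hs]
  have hfhat : DifferentiableOn ℂ (fun z => f ((dil ℓ b : ℂ)⁻¹ * (z - Complex.I * c)))
      rightHalfPlane := hf.comp (by fun_prop) hinv
  have hghat : DifferentiableOn ℂ (fun z => (dil ℓ b : ℂ) *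
      g ((dil ℓ b : ℂ)⁻¹ * (z - Complex.I * c)) + Complex.I * c) rightHalfPlane :=
    ((hg.comp (by fun_prop) hinv).const_mul _).add_const _
  have hghatmaps : MapsTo (fun z => (dil ℓ b : ℂ) *
      g ((dil ℓ b : ℂ)⁻¹ * (z - Complex.I * c)) + Complex.I * c) rightHalfPlane rightHalfPlane :=
    fun z hz => haff _ (hgmaps (hinv hz))
  have h12 := isConjSelfAdjoint_unitaryConj_iff (bergmanU ℓ b hb c) (bergmanC ℓ)
    (bergmanUCU ℓ b hb c)
    (fun x => by rw [bergmanUCU_apply, LinearIsometryEquiv.symm_apply_apply]) (wcoMax ℓ f g)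
  have h2s := isConjSelfAdjoint_bergmanC_iff (ℓ := ℓ) hfhat hghat hghatmaps
  refine ⟨hU, ?_, fun h => ?_⟩
  · tfae_have 1 ↔ 2 := h12
    tfae_have 2 ↔ 3 := by
      -- The criterion for C⋆ applies to the transformed symbols; putting z = s w + i c and solving
      -- for g(w) turns each of its cases into the stated one.
      rw [← hU, h2s, StarSymbol]
      refine or_congr ?_ (or_congr ?_ (or_congr ?_ ?_))
      · rw [forall_mem_rightHalfPlane_affine hs c]
        simp only [inv_mul_affine_sub hs]
      · refine exists₂_congr fun α β => and_congr Iff.rfl ?_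
        rw [forall_mem_rightHalfPlane_affine hs c]
        refine forall₂_congr fun w _ => ?_
        rw [inv_mul_affine_sub hs, mul_add_eq_iff hs0]
      · refine exists₂_congr fun lam θ => and_congr Iff.rfl ?_
        rw [forall_mem_rightHalfPlane_affine hs c]
        refine forall₂_congr fun w _ => ?_
        rw [inv_mul_affine_sub hs, mul_add_eq_iff hs0]
        have e : (dil ℓ b : ℂ)⁻¹ * (lam * (dil ℓ b * w + Complex.I * c) - Complex.I * c) =
            lam * (w + Complex.I * c * (dil ℓ b : ℂ)⁻¹) - Complex.I * c * (dil ℓ b : ℂ)⁻¹ := by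
          field_simp
        rw [e]
      · refine exists_congr fun δ => exists₂_congr fun κ r => and_congr Iff.rfl ?_
        rw [forall_mem_rightHalfPlane_affine hs c]
        refine forall₂_congr fun w _ => ?_
        rw [inv_mul_affine_sub hs, mul_add_eq_iff hs0]
    tfae_finish
  · have h3 := h2s.1 (hU ▸ h12.1 h)
    exact (hU ▸ h3.isBoundedPMap hghatmaps : IsBoundedPMap (unitaryConj _ _)).of_unitaryConj
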